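/- For $p,q\ge 0$ write ${}_pF_q(a_1,\dots,a_p;b_1,\dots,b_q;z)=\sum_{n\ge 0}\frac{(a_1)_n\cdots(a_p)_n}{(b_1)_n\cdots(b_q)_n}\frac{z^n}{n!}$, where $(x)_n=x(x+1)\cdots(x+n-1)$ is the rising Pochhammer symbol; let $\mathrm{Li}_3(z)=\sum_{k\ge 1} z^k/k^3$ for $|z|<1$, and let $K=\sum_{n\ge 0}\frac{(-1)^n}{(2n+1)^2}$ be Catalan's constant. Then all the series below converge, and $$\sum_{n\ge 0}\frac{1}{(2n+1)^2}\left[\frac{1}{4^n}\binom{2n}{n}\right]^2={}_4F_3\left(\tfrac12,\tfrac12,\tfrac12,\tfrac12;1,\tfrac32,\tfrac32;1\right)=\frac{3\pi^2}{8}+\frac{\log^2 2}{2}-\frac{16}{\pi}\,\mathrm{Im}\,\mathrm{Li}_3\left(\tfrac{1+i}{2}\right),$$ $$\sum_{n\ge 0}\frac{1}{(2n-1)^4}\left[\frac{1}{4^n}\binom{2n}{n}\right]^2={}_4F_3\left(-\tfrac12,-\tfrac12,-\tfrac12,-\tfrac12;1,\tfrac12,\tfrac12;1\right)=\frac{3\pi^2}{8}+\frac{\log^2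 2}{2}-\frac{16}{\pi}\,\mathrm{Im}\,\mathrm{Li}_3\left(\tfrac{1+i}{2}\right)-\frac{8}{\pi}(K-1).$$ -/

import Mathlib

noncomputable section

/-- The `n`-th term `(a₁)ₙ ⋯ (a_p)ₙ / ((b₁)ₙ ⋯ (b_q)ₙ) · zⁿ / n!` of the generalized hypergeometric
series with upper parameters `a`, lower parameters `b` and argument `z`; `(x)ₙ` is the rising
Pochhammer symbol. -/
def hypergeometricTerm {p q : ℕ} (a : Fin p → ℝ) (b : Fin q → ℝ) (z : ℝ) (n : ℕ) : ℝ :=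
  (∏ i, (ascPochhammer ℝ n).eval (a i)) / (∏ j, (ascPochhammer ℝ n).eval (b j)) *
    (z ^ n / (n.factorial : ℝ))

/-- The generalized hypergeometric function `pFq(a; b; z)`, as the sum of its series. -/
def hypergeometricPFQ {p q : ℕ} (a : Fin p → ℝ) (b : Fin q → ℝ) (z : ℝ) : ℝ :=
  ∑' n : ℕ, hypergeometricTerm a b z n

/-- The polylogarithm `Li_s(z) = ∑_{k ≥ 1} z^k / k^s`, for `|z| < 1`. -/
def polyLog (s : ℕ) (z : ℂ) : ℂ :=
  ∑' k : ℕ, z ^ (k + 1) / ((k : ℂ) + 1) ^ s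

/-- Catalan's constant `∑_{n ≥ 0} (-1)^n / (2n+1)^2`. -/
def catalanConstant : ℝ :=
  ∑' n : ℕ, (-1 : ℝ) ^ n / (2 * (n : ℝ) + 1) ^ 2

end

/-! Write c_n for `centralRatio n`, L = log tan(θ/2), K for Catalan's constant and A(x) for the
integral of arctan t · log(1+t²)/t over [0, x]. The Pochhammer quotients reduce both hypergeometric
series to sums in c_n².

For the first sum, one factor c_n/(2n+1) comes from the moment of -cos θ · L against sin^(2n) θ on
(0, π/2), and the other from the arcsine series θ/sin θ = Σ c_n/(2n+1) sin^(2n) θ. Interchanging sum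
and integral, π/2 times the sum is the integral of -θ cot θ · L. Integration by parts
(`integral_mul_cot_mul_neg_log_tan_half`) turns this into half the integral of L² + 4 log cos(θ/2) ·
L, minus 2A(1).

That quadratic integral follows from Cauchy's theorem on a quarter disc
(`integral_logTanQuadratic`). With f(z) = log((1-z)/(1+z)), the form f(z)(f(z) + 4 log(1+z) - 4 log
2) dz/z is real on the real radius. On the imaginary radius its imaginary part integrates to -4A + 8
log 2 times the inverse tangent integral, and on the unit arc it yields the wanted integrand plus a
linear term of integral zero. The total is 4(K log 2 - A(1)).

Landen's identity gives A in terms of Li₂ and Li₃ (`hasDerivAt_landenTrilog`). At x = 1 the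
arguments are -i and i/(1+i) = (1+i)/2, and the K log 2 in A(1) cancels the one above
(`arctanLogPrimitive_one`).

The second sum, shifted by one index, splits by partial fractions into the first sum, Σ c_n²/(2n+1)
= 4K/π, and two telescoping sums (`hasSum_centralRatio_sq_div_pow_four`). -/

open Real Filter Topology MeasureTheory Set

/-! ### Central binomial ratios, Wallis' product and Pochhammer values -/

/-- The normalized central binomial coefficient `C(2n, n) / 4^n`. -/
noncomputable def centralRatio (n : ℕ) : ℝ := 1 / 4 ^ n * ((2 * n).choose n : ℝ)

theorem centralRatio_zero : centralRatio 0 = 1 := by simp [centralRatio]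

theorem centralRatio_succ (n : ℕ) :
    centralRatio (n + 1) = centralRatio n * ((2 * n + 1) / (2 * n + 2)) := by
  have h := Nat.succ_mul_centralBinom_succ n
  rw [Nat.centralBinom_eq_two_mul_choose, Nat.centralBinom_eq_two_mul_choose] at h
  have h' : ((n : ℝ) + 1) * ((2 * (n + 1)).choose (n + 1) : ℝ) =
      2 * (2 * n + 1) * ((2 * n).choose n : ℝ) := by exact_mod_cast h
  have hn : (n : ℝ) + 1 ≠ 0 := by positivity
  have h2 : ((2 * (n + 1)).choose (n + 1) : ℝ) =
      2 * (2 * n + 1) * ((2 * n).choose n : ℝ) / (n + 1) := by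
    rw [eq_div_iff hn, ← h']; ring
  unfold centralRatio
  rw [h2]
  have : (2 * (n : ℝ) + 2) ≠ 0 := by positivity
  field_simp
  ring

theorem centralRatio_pos (n : ℕ) : 0 < centralRatio n := by
  induction n with
  | zero => simp [centralRatio_zero]
  | succ n ih => rw [centralRatio_succ]; positivity

theorem centralRatio_le_one (n : ℕ) : centralRatio n ≤ 1 := by
  induction n with
  | zero => simp [centralRatio_zero]
  | succ n ih =>
    rw [centralRatio_succ]
    have : (2 * (n : ℝ) + 1) / (2 * n + 2) ≤ 1 := by
      rw [div_le_one (by positivity)]; linarith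
    exact mul_le_one₀ ih (by positivity) this

theorem centralRatio_eq_prod (n : ℕ) :
    centralRatio n = ∏ i ∈ Finset.range n, (2 * (i : ℝ) + 1) / (2 * i + 2) := by
  induction n with
  | zero => simp [centralRatio_zero]
  | succ n ih => rw [centralRatio_succ, Finset.prod_range_succ, ih]

theorem wallis_eq_centralRatio (n : ℕ) :
    Real.Wallis.W n = 1 / (centralRatio n ^ 2 * (2 * n + 1)) := by
  induction n with
  | zero => simp [centralRatio_zero, Real.Wallis.W]
  | succ n ih =>
    rw [Real.Wallis.W_succ, ih, centralRatio_succ]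
    have := (centralRatio_pos n).ne'
    push_cast
    field_simp
    ring

theorem tendsto_mul_centralRatio_sq :
    Tendsto (fun n : ℕ => (n : ℝ) * centralRatio n ^ 2) atTop (𝓝 (1 / π)) := by
  have h1 := (Real.Wallis.tendsto_W_nhds_pi_div_two).inv₀ (by positivity)
  have h2 : Tendsto (fun n : ℕ => (n : ℝ) / (2 * n + 1)) atTop (𝓝 (1 / 2)) := by
    have h3 : Tendsto (fun n : ℕ => 1 / 2 - 1 / 4 * (1 / ((n : ℝ) + 1 / 2))) atTop
        (𝓝 (1 / 2 - 1 / 4 * 0)) := by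
      refine tendsto_const_nhds.sub (tendsto_const_nhds.mul ?_)
      simp_rw [one_div]
      exact tendsto_inv_atTop_zero.comp
        (tendsto_atTop_add_const_right _ _ tendsto_natCast_atTop_atTop)
    rw [mul_zero, sub_zero] at h3
    refine h3.congr fun n => ?_
    field_simp
    ring
  have h3 := h1.mul h2
  have e : (π / 2)⁻¹ * (1 / 2) = 1 / π := by field_simp
  rw [e] at h3
  refine h3.congr fun n => ?_
  rw [wallis_eq_centralRatio]
  have := (centralRatio_pos n).ne'
  field_simp

theorem ascPochhammer_eval_one_half (n : ℕ) :
    (ascPochhammer ℝ n).eval (1 / 2) = centralRatio n * n.factorial := by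
  induction n with
  | zero => simp [centralRatio_zero]
  | succ n ih =>
    rw [ascPochhammer_succ_eval, ih, centralRatio_succ, Nat.factorial_succ]
    push_cast
    field_simp
    ring

theorem ascPochhammer_eval_three_halves (n : ℕ) :
    (ascPochhammer ℝ n).eval (3 / 2) = (2 * n + 1) * (centralRatio n * n.factorial) := by
  induction n with
  | zero => simp [centralRatio_zero]
  | succ n ih =>
    rw [ascPochhammer_succ_eval, ih, centralRatio_succ, Nat.factorial_succ]
    push_cast
    field_simp
    ring

theorem two_mul_natCast_sub_one_ne_zero (n : ℕ) : 2 * (n : ℝ) - 1 ≠ 0 := by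
  intro h
  have h1 : (2 * n : ℝ) = 1 := by linarith
  have h2 : 2 * n = 1 := by exact_mod_cast h1
  omega

theorem ascPochhammer_eval_neg_one_half (n : ℕ) :
    (ascPochhammer ℝ n).eval (-1 / 2) = -(centralRatio n * n.factorial) / (2 * n - 1) := by
  induction n with
  | zero => simp [centralRatio_zero]
  | succ n ih =>
    have h1 := two_mul_natCast_sub_one_ne_zero n
    have h2 := two_mul_natCast_sub_one_ne_zero (n + 1)
    push_cast at h2
    rw [ascPochhammer_succ_eval, ih, centralRatio_succ, Nat.factorial_succ]
    push_cast
    have e : 2 * ((n : ℝ) + 1) - 1 = 2 * n + 1 := by ring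
    rw [e]
    field_simp
    ring

theorem hypergeometricTerm_one_half (n : ℕ) :
    hypergeometricTerm ![1/2, 1/2, 1/2, 1/2] ![1, 3/2, 3/2] 1 n =
      1 / (2 * (n : ℝ) + 1) ^ 2 * centralRatio n ^ 2 := by
  have h := (centralRatio_pos n).ne'
  have hf : (n.factorial : ℝ) ≠ 0 := by positivity
  simp only [hypergeometricTerm, Fin.prod_univ_four, Fin.prod_univ_three, Matrix.cons_val_zero,
    Matrix.cons_val_one, Matrix.cons_val, ascPochhammer_eval_one_half,
    ascPochhammer_eval_three_halves, ascPochhammer_eval_one, one_pow]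
  field_simp

theorem hypergeometricTerm_neg_one_half (n : ℕ) :
    hypergeometricTerm ![-1/2, -1/2, -1/2, -1/2] ![1, 1/2, 1/2] 1 n =
      1 / (2 * (n : ℝ) - 1) ^ 4 * centralRatio n ^ 2 := by
  have h := (centralRatio_pos n).ne'
  have hf : (n.factorial : ℝ) ≠ 0 := by positivity
  have h1 := two_mul_natCast_sub_one_ne_zero n
  simp only [hypergeometricTerm, Fin.prod_univ_four, Fin.prod_univ_three, Matrix.cons_val_zero,
    Matrix.cons_val_one, Matrix.cons_val, ascPochhammer_eval_one_half,
    ascPochhammer_eval_neg_one_half, ascPochhammer_eval_one, one_pow]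
  field_simp

/-! ### Sine moments and the arcsine series -/

theorem integral_sin_pow_even_zero_pi_div_two (n : ℕ) :
    ∫ x in (0 : ℝ)..(π / 2), sin x ^ (2 * n) = π / 2 * centralRatio n := by
  have h := integral_sin_pow_even (n := n)
  rw [← centralRatio_eq_prod] at h
  have hi : ∀ a b : ℝ, IntervalIntegrable (fun x => sin x ^ (2 * n)) volume a b := fun a b =>
    (by fun_prop : Continuous fun x : ℝ => sin x ^ (2 * n)).intervalIntegrable a b
  have h2 := intervalIntegral.integral_add_adjacent_intervals (hi 0 (π / 2)) (hi (π / 2) π)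
  have h3 : ∫ x in (π / 2)..π, sin x ^ (2 * n) = ∫ x in (0 : ℝ)..(π / 2), sin x ^ (2 * n) := by
    have := intervalIntegral.integral_comp_sub_left (a := 0) (b := π / 2)
      (fun x : ℝ => sin x ^ (2 * n)) π
    simp only [sin_pi_sub] at this
    rw [this]
    congr 1 <;> ring
  linarith

theorem hasSum_centralRatio_mul_pow {x : ℝ} (hx : |x| < 1) :
    HasSum (fun n => centralRatio n * x ^ n) (1 / √(1 - x)) := by
  have h := (Real.one_div_one_sub_rpow_hasFPowerSeriesOnBall_zero (1 / 2)).hasSum (y := x) (by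
    simpa [enorm_eq_nnnorm, ← NNReal.coe_lt_coe] using hx)
  rw [zero_add, ← Real.sqrt_eq_rpow] at h
  refine h.congr_fun fun n => ?_
  -- The binomial coefficient of (1-x)^(-1/2) is (1/2)_n / n!, which is `centralRatio n`.
  have e : Ring.choose ((1 : ℝ) / 2 + n - 1) n = centralRatio n := by
    have h1 := Ring.descPochhammer_eq_factorial_smul_choose ((1 : ℝ) / 2 + n - 1) n
    rw [Polynomial.descPochhammer_smeval_eq_ascPochhammer] at h1
    have e2 : (1 : ℝ) / 2 + n - 1 - n + 1 = 1 / 2 := by ring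
    rw [e2, Polynomial.ascPochhammer_smeval_eq_eval, ascPochhammer_eval_one_half,
      nsmul_eq_mul, mul_comm] at h1
    exact (mul_left_cancel₀ (by positivity) h1).symm
  rw [← e]
  simp [FormalMultilinearSeries.ofScalars, mul_comm]

theorem summable_centralRatio_div_mul_pow {x : ℝ} (hx : |x| < 1) :
    Summable fun n : ℕ => centralRatio n / (2 * n + 1) * x ^ (2 * n + 1) := by
  have hg : Summable fun n : ℕ => |x| ^ n := summable_geometric_of_lt_one (abs_nonneg x) hx
  refine hg.of_norm_bounded fun n => ?_
  have h0 := (centralRatio_pos n).le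
  have h1 : centralRatio n / (2 * n + 1) ≤ 1 := by
    rw [div_le_one (by positivity)]
    have : (0 : ℝ) ≤ n := n.cast_nonneg
    linarith [centralRatio_le_one n]
  rw [norm_mul, norm_pow, Real.norm_eq_abs, Real.norm_eq_abs, abs_of_nonneg (by positivity)]
  calc _ ≤ 1 * |x| ^ n := mul_le_mul h1
        (pow_le_pow_of_le_one (abs_nonneg x) hx.le (by omega)) (by positivity) zero_le_one
    _ = _ := one_mul _

theorem hasDerivAt_arcsin_series {x : ℝ} (hx : |x| < 1) :
    HasDerivAt (fun y : ℝ => ∑' n : ℕ, centralRatio n / (2 * n + 1) * y ^ (2 * n + 1))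
      (1 / √(1 - x ^ 2)) x := by
  obtain ⟨r, hxr, hr1⟩ := exists_between hx
  have hr0 : 0 ≤ r := (abs_nonneg x).trans hxr.le
  have hg : Summable fun n : ℕ => r ^ n := summable_geometric_of_lt_one hr0 hr1
  have key := hasDerivAt_tsum_of_isPreconnected (𝕜 := ℝ) (F := ℝ) (t := Ioo (-r) r)
    (g := fun (n : ℕ) y => centralRatio n / (2 * n + 1) * y ^ (2 * n + 1))
    (g' := fun (n : ℕ) y => centralRatio n * (y ^ 2) ^ n) (y₀ := x) (y := x) hg isOpen_Ioo
    isPreconnected_Ioo ?_ ?_ (abs_lt.mp hxr) (summable_centralRatio_div_mul_pow hx)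
    (abs_lt.mp hxr)
  · rwa [(hasSum_centralRatio_mul_pow (x := x ^ 2) _).tsum_eq] at key
    rw [abs_pow]
    exact pow_lt_one₀ (abs_nonneg x) hx two_ne_zero
  · intro n y _
    have := (hasDerivAt_pow (2 * n + 1) y).const_mul (centralRatio n / (2 * (n : ℝ) + 1))
    refine this.congr_deriv ?_
    push_cast
    rw [pow_mul]
    field_simp
  · intro n y hy
    have hy' : |y| ≤ r := (abs_lt.mpr hy).le
    rw [norm_mul, Real.norm_eq_abs, abs_of_pos (centralRatio_pos n), norm_pow, norm_pow,
      Real.norm_eq_abs, ← pow_mul]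
    calc _ ≤ 1 * r ^ n := by
          refine mul_le_mul (centralRatio_le_one n) ?_ (by positivity) zero_le_one
          exact (pow_le_pow_left₀ (abs_nonneg y) hy' _).trans
            (pow_le_pow_of_le_one hr0 hr1.le (by omega))
      _ = _ := one_mul _

theorem hasSum_arcsin {x : ℝ} (hx : |x| < 1) :
    HasSum (fun n : ℕ => centralRatio n / (2 * n + 1) * x ^ (2 * n + 1)) (arcsin x) := by
  have h := (summable_centralRatio_div_mul_pow hx).hasSum
  convert h using 1
  have hd : ∀ y ∈ Ioo (-1 : ℝ) 1, HasDerivAt (fun y => arcsin y -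
      ∑' n : ℕ, centralRatio n / (2 * n + 1) * y ^ (2 * n + 1)) 0 y := fun y hy => by
    have := (hasDerivAt_arcsin hy.1.ne' hy.2.ne).fun_sub (hasDerivAt_arcsin_series (abs_lt.mpr hy))
    exact this.congr_deriv (sub_self _)
  have hc := isOpen_Ioo.is_const_of_deriv_eq_zero (s := Ioo (-1 : ℝ) 1) isPreconnected_Ioo
    (fun y hy => (hd y hy).differentiableAt.differentiableWithinAt)
    (fun y hy => (hd y hy).deriv) (abs_lt.mp hx) (show (0 : ℝ) ∈ Ioo (-1 : ℝ) 1 by simp)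
  simp at hc
  linarith

theorem hasSum_centralRatio_div_mul_sin_pow {θ : ℝ} (hθ : θ ∈ Ioo 0 (π / 2)) :
    HasSum (fun n : ℕ => centralRatio n / (2 * n + 1) * sin θ ^ (2 * n)) (θ / sin θ) := by
  have hs : 0 < sin θ := sin_pos_of_pos_of_lt_pi hθ.1 (by linarith [hθ.2, pi_pos])
  have hc : 0 < cos θ := cos_pos_of_mem_Ioo ⟨by linarith [hθ.1, pi_pos], hθ.2⟩
  have h1 : sin θ < 1 := by nlinarith [sin_sq_add_cos_sq θ]
  have h := hasSum_arcsin (x := sin θ) (by rwa [abs_of_pos hs])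
  rw [arcsin_sin (by linarith [hθ.1, pi_pos]) hθ.2.le] at h
  refine (h.div_const (sin θ)).congr_fun fun n => ?_
  rw [pow_succ]
  field_simp

/-! ### Polylogarithms on the unit disc -/

theorem norm_polyLog_term_le (s k : ℕ) {z : ℂ} (hz : ‖z‖ ≤ 1) :
    ‖z ^ (k + 1) / ((k : ℂ) + 1) ^ s‖ ≤ 1 / ((k : ℝ) + 1) ^ s := by
  have e : ‖(k : ℂ) + 1‖ = (k : ℝ) + 1 := by
    rw [← Nat.cast_succ, Complex.norm_natCast, Nat.cast_succ]
  rw [norm_div, norm_pow, norm_pow, e]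
  gcongr
  exact pow_le_one₀ (norm_nonneg z) hz

theorem summable_one_div_succ_pow {s : ℕ} (hs : 2 ≤ s) :
    Summable fun k : ℕ => 1 / ((k : ℝ) + 1) ^ s := by
  have := (summable_nat_add_iff 1).mpr (Real.summable_one_div_nat_pow.mpr (by omega : 1 < s))
  simpa using this

theorem hasSum_polyLog {s : ℕ} (hs : 2 ≤ s) {z : ℂ} (hz : ‖z‖ ≤ 1) :
    HasSum (fun k : ℕ => z ^ (k + 1) / ((k : ℂ) + 1) ^ s) (polyLog s z) :=
  ((summable_one_div_succ_pow hs).of_norm_bounded fun k => norm_polyLog_term_le s k hz).hasSum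

/-- The final evaluation uses the boundary point -i, where the derivative formula is not available;
continuity on the closed disc carries the identities there. -/
theorem continuousOn_polyLog {s : ℕ} (hs : 2 ≤ s) :
    ContinuousOn (polyLog s) (Metric.closedBall 0 1) :=
  continuousOn_tsum (fun k => by fun_prop) (summable_one_div_succ_pow hs) fun k z hz =>
    norm_polyLog_term_le s k (by simpa using hz)

theorem polyLog_zero_right (s : ℕ) : polyLog s 0 = 0 := by simp [polyLog]

theorem polyLog_one_eq {z : ℂ} (hz : ‖z‖ < 1) : polyLog 1 z = -Complex.log (1 - z) := by
  have h := (hasSum_nat_add_iff' 1).mpr (Complex.hasSum_taylorSeries_neg_log hz)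
  simp only [Finset.range_one, Finset.sum_singleton, pow_zero, Nat.cast_zero, div_zero,
    sub_zero] at h
  rw [← h.tsum_eq]
  simp [polyLog]

theorem hasDerivAt_polyLog (s : ℕ) {z : ℂ} (hz : ‖z‖ < 1) (hz0 : z ≠ 0) :
    HasDerivAt (polyLog (s + 1)) (polyLog s z / z) z := by
  obtain ⟨r, hzr, hr1⟩ := exists_between hz
  have hr0 : 0 ≤ r := (norm_nonneg z).trans hzr.le
  have hg : Summable fun n : ℕ => r ^ n := summable_geometric_of_lt_one hr0 hr1
  have e : ∀ k : ℕ, ‖(k : ℂ) + 1‖ = (k : ℝ) + 1 := fun k => by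
    rw [← Nat.cast_succ, Complex.norm_natCast, Nat.cast_succ]
  have hk0 : ∀ k : ℕ, (k : ℂ) + 1 ≠ 0 := fun k => Nat.cast_add_one_ne_zero k
  have hmem : z ∈ Metric.ball (0 : ℂ) r := by simpa using hzr
  have key := hasDerivAt_tsum_of_isPreconnected (𝕜 := ℂ) (F := ℂ) (t := Metric.ball 0 r)
    (g := fun (k : ℕ) w => w ^ (k + 1) / ((k : ℂ) + 1) ^ (s + 1))
    (g' := fun (k : ℕ) w => w ^ k / ((k : ℂ) + 1) ^ s) (y₀ := 0) (y := z) hg Metric.isOpen_ball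
    (convex_ball 0 r).isPreconnected ?_ ?_
    (by simpa using (norm_nonneg z).trans_lt hzr) (by simp) hmem
  · refine key.congr_deriv ?_
    rw [polyLog, ← tsum_div_const]
    refine tsum_congr fun k => ?_
    rw [pow_succ]
    field_simp
  · intro k w _
    refine ((hasDerivAt_pow (k + 1) w).div_const _).congr_deriv ?_
    have := hk0 k
    push_cast
    rw [pow_succ]
    field_simp
  · intro k w hw
    have hw' : ‖w‖ ≤ r := by simpa using (Metric.mem_ball.mp hw).le
    rw [norm_div, norm_pow, norm_pow, e]
    have h1 : (1 : ℝ) ≤ ((k : ℝ) + 1) ^ s := one_le_pow₀ (by linarith [k.cast_nonneg (α := ℝ)])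
    calc _ ≤ ‖w‖ ^ k := div_le_self (by positivity) h1
      _ ≤ r ^ k := pow_le_pow_left₀ (norm_nonneg w) hw' k

/-! ### Landen's transformation z ↦ z/(1+z) -/

theorem one_add_mem_slitPlane {z : ℂ} (hz : 0 ≤ z.re) : 1 + z ∈ Complex.slitPlane :=
  Or.inl (by simp only [Complex.add_re, Complex.one_re]; linarith)

/-- This rests on |1+z|² - |z|² = 1 + 2 Re z > 0. -/
theorem norm_div_one_add_lt_one {z : ℂ} (hz : 0 ≤ z.re) : ‖z / (1 + z)‖ < 1 := by
  have h0 : 1 + z ≠ 0 := Complex.slitPlane_ne_zero (one_add_mem_slitPlane hz)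
  rw [norm_div, div_lt_one (norm_pos_iff.mpr h0)]
  refine lt_of_pow_lt_pow_left₀ 2 (norm_nonneg _) ?_
  rw [Complex.sq_norm, Complex.sq_norm, Complex.normSq_apply, Complex.normSq_apply]
  simp only [Complex.add_re, Complex.one_re, Complex.add_im, Complex.one_im]
  nlinarith

theorem hasDerivAt_log_one_add {z : ℂ} (hz : 0 ≤ z.re) :
    HasDerivAt (fun w : ℂ => Complex.log (1 + w)) (1 / (1 + z)) z :=
  ((hasDerivAt_id z).const_add 1).clog (one_add_mem_slitPlane hz)

theorem hasDerivAt_polyLog_div_one_add (s : ℕ) {z : ℂ} (hz : 0 ≤ z.re) (hz0 : z ≠ 0) :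
    HasDerivAt (fun w : ℂ => polyLog (s + 1) (w / (1 + w)))
      (polyLog s (z / (1 + z)) / (z * (1 + z))) z := by
  have h0 : 1 + z ≠ 0 := Complex.slitPlane_ne_zero (one_add_mem_slitPlane hz)
  have h1 : HasDerivAt (fun w : ℂ => w / (1 + w)) (1 / (1 + z) ^ 2) z := by
    refine ((hasDerivAt_id z).fun_div ((hasDerivAt_id z).const_add 1) h0).congr_deriv ?_
    simp
  refine ((hasDerivAt_polyLog s (norm_div_one_add_lt_one hz) (div_ne_zero hz0 h0)).comp z
    h1).congr_deriv ?_
  field_simp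

theorem hasDerivAt_polyLog_neg (s : ℕ) {z : ℂ} (hz : ‖z‖ < 1) (hz0 : z ≠ 0) :
    HasDerivAt (fun w : ℂ => polyLog (s + 1) (-w)) (polyLog s (-z) / z) z := by
  refine ((hasDerivAt_polyLog s (z := -z) (by simpa using hz) (neg_ne_zero.mpr hz0)).comp z
    (hasDerivAt_neg z)).congr_deriv ?_
  field_simp

theorem polyLog_one_div_one_add {z : ℂ} (hz : 0 ≤ z.re) :
    polyLog 1 (z / (1 + z)) = Complex.log (1 + z) := by
  have hs := one_add_mem_slitPlane hz
  have h0 : 1 + z ≠ 0 := Complex.slitPlane_ne_zero hs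
  rw [polyLog_one_eq (norm_div_one_add_lt_one hz)]
  have : 1 - z / (1 + z) = (1 + z)⁻¹ := by field_simp; ring
  rw [this, Complex.log_inv _ (Complex.mem_slitPlane_iff_arg.mp hs).1, neg_neg]

/-- The difference of the two sides of the Landen identity for the dilogarithm. -/
noncomputable def landenDilog (z : ℂ) : ℂ :=
  polyLog 2 (z / (1 + z)) + polyLog 2 (-z) + Complex.log (1 + z) ^ 2 / 2

/-- All three derivatives are multiples of log(1+z), with coefficients 1/(z(1+z)), -1/z and 1/(1+z),
which add up to zero. -/
theorem hasDerivAt_landenDilog {z : ℂ} (hz : ‖z‖ < 1) (hre : 0 ≤ z.re) (hz0 : z ≠ 0) :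
    HasDerivAt landenDilog 0 z := by
  have h0 : 1 + z ≠ 0 := Complex.slitPlane_ne_zero (one_add_mem_slitPlane hre)
  refine (((hasDerivAt_polyLog_div_one_add 1 hre hz0).fun_add
    (hasDerivAt_polyLog_neg 1 hz hz0)).fun_add
    (((hasDerivAt_log_one_add hre).fun_pow 2).div_const 2)).congr_deriv ?_
  rw [polyLog_one_div_one_add hre, polyLog_one_eq (z := -z) (by simpa using hz), sub_neg_eq_add]
  field_simp
  ring

theorem continuousOn_polyLog_comp {s : ℕ} (hs : 2 ≤ s) {g : ℝ → ℂ} {S : Set ℝ}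
    (hg : ContinuousOn g S) (h : ∀ x ∈ S, ‖g x‖ ≤ 1) :
    ContinuousOn (fun x => polyLog s (g x)) S :=
  (continuousOn_polyLog hs).comp hg fun x hx => by simpa using h x hx

theorem one_add_ofReal_mul_I_ne_zero (x : ℝ) : 1 + (x : ℂ) * Complex.I ≠ 0 :=
  Complex.slitPlane_ne_zero (one_add_mem_slitPlane (by simp))

theorem continuous_log_one_add_mul_I :
    Continuous fun x : ℝ => Complex.log (1 + (x : ℂ) * Complex.I) :=
  Continuous.clog (by fun_prop) fun x => one_add_mem_slitPlane (by simp)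

theorem continuousOn_polyLog_div_one_add_mul_I {s : ℕ} (hs : 2 ≤ s) :
    ContinuousOn (fun x : ℝ => polyLog s (x * Complex.I / (1 + x * Complex.I))) (Icc 0 1) :=
  continuousOn_polyLog_comp hs (Continuous.continuousOn (Continuous.div (by fun_prop)
    (by fun_prop) one_add_ofReal_mul_I_ne_zero))
    fun x _ => (norm_div_one_add_lt_one (by simp)).le

theorem continuousOn_polyLog_neg_mul_I {s : ℕ} (hs : 2 ≤ s) :
    ContinuousOn (fun x : ℝ => polyLog s (-(x * Complex.I))) (Icc 0 1) :=
  continuousOn_polyLog_comp hs (by fun_prop) fun x hx => by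
    simpa [abs_of_nonneg hx.1] using hx.2

theorem HasDerivAt.comp_ofReal_mul_I {f : ℂ → ℂ} {f' : ℂ} {x : ℝ}
    (h : HasDerivAt f f' (x * Complex.I)) :
    HasDerivAt (fun t : ℝ => f (t * Complex.I)) (f' * Complex.I) x := by
  have h1 : HasDerivAt (fun w : ℂ => w * Complex.I) Complex.I (x : ℂ) := by
    simpa using (hasDerivAt_id (x : ℂ)).mul_const Complex.I
  exact (HasDerivAt.comp (x : ℂ) h h1).comp_ofReal

theorem polyLog_two_landen {x : ℝ} (hx : x ∈ Ioo (0 : ℝ) 1) :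
    polyLog 2 (x * Complex.I / (1 + x * Complex.I)) =
      -polyLog 2 (-(x * Complex.I)) - Complex.log (1 + x * Complex.I) ^ 2 / 2 := by
  have hsub : Icc 0 x ⊆ Icc (0 : ℝ) 1 := Icc_subset_Icc_right hx.2.le
  have hc : ContinuousOn (fun t : ℝ => landenDilog (t * Complex.I)) (Icc 0 x) :=
    (((continuousOn_polyLog_div_one_add_mul_I le_rfl).mono hsub).add
      ((continuousOn_polyLog_neg_mul_I le_rfl).mono hsub)).add
      ((continuous_log_one_add_mul_I.pow 2).div_const 2).continuousOn
  have h := intervalIntegral.integral_eq_sub_of_hasDerivAt_of_le (f' := fun _ => (0 : ℂ)) hx.1.le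
    hc (fun t ht => by
      have h1 := (hasDerivAt_landenDilog (z := t * Complex.I)
        (by simpa [abs_of_pos ht.1] using ht.2.trans hx.2) (by simp)
        (by simp [ht.1.ne'])).comp_ofReal_mul_I
      simpa using h1) (by simp)
  simp only [landenDilog, intervalIntegral.integral_zero, Complex.ofReal_zero, zero_mul,
    zero_div, neg_zero, polyLog_zero_right, add_zero, Complex.log_one] at h
  linear_combination -h

/-- A function whose restriction to the imaginary axis is a primitive of `log² (1 + z) / (2 z)`. -/
noncomputable def landenTrilog (z : ℂ) : ℂ :=
  polyLog 3 (z / (1 + z)) + polyLog 3 (-z) - Complex.log (1 + z) * polyLog 2 (-z)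
    - Complex.log (1 + z) ^ 3 / 6

/-- Once Landen's dilogarithm identity replaces Li₂(z/(1+z)), the remaining Li₂(-z) terms cancel and
only log²(1+z)/(2z) is left. Its imaginary part at z = ix supplies arctan x · log(1+x²). -/
theorem hasDerivAt_landenTrilog {x : ℝ} (hx : x ∈ Ioo (0 : ℝ) 1) :
    HasDerivAt (fun t : ℝ => landenTrilog (t * Complex.I))
      (Complex.log (1 + x * Complex.I) ^ 2 / (2 * x)) x := by
  have hz : ‖(x : ℂ) * Complex.I‖ < 1 := by simpa [abs_of_pos hx.1] using hx.2
  have hre : 0 ≤ ((x : ℂ) * Complex.I).re := by simp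
  have hx0 : (x : ℂ) ≠ 0 := by exact_mod_cast hx.1.ne'
  have hz0 : (x : ℂ) * Complex.I ≠ 0 := mul_ne_zero hx0 Complex.I_ne_zero
  have h0 := one_add_ofReal_mul_I_ne_zero x
  have h := ((((hasDerivAt_polyLog_div_one_add 2 hre hz0).fun_add
    (hasDerivAt_polyLog_neg 2 hz hz0)).fun_sub
    ((hasDerivAt_log_one_add hre).fun_mul (hasDerivAt_polyLog_neg 1 hz hz0))).fun_sub
    (((hasDerivAt_log_one_add hre).fun_pow 3).div_const 6)).comp_ofReal_mul_I
  refine h.congr_deriv ?_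
  rw [polyLog_two_landen hx, polyLog_one_eq (z := -(x * Complex.I)) (by simpa using hz),
    sub_neg_eq_add]
  have hI := Complex.I_ne_zero
  field_simp
  ring

theorem continuousOn_landenTrilog :
    ContinuousOn (fun t : ℝ => landenTrilog (t * Complex.I)) (Icc 0 1) :=
  (((continuousOn_polyLog_div_one_add_mul_I (by norm_num)).add
    (continuousOn_polyLog_neg_mul_I (by norm_num))).sub
    (continuous_log_one_add_mul_I.continuousOn.mul (continuousOn_polyLog_neg_mul_I le_rfl))).sub
    ((continuous_log_one_add_mul_I.pow 3).div_const 6).continuousOn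

/-! ### Real primitives from the imaginary axis -/

theorem log_one_add_mul_I (x : ℝ) :
    Complex.log (1 + x * Complex.I) = (log (1 + x ^ 2) / 2 : ℝ) + (arctan x : ℝ) * Complex.I := by
  have hpos : (0 : ℝ) < 1 + x ^ 2 := by positivity
  have hs : 0 < √(1 + x ^ 2) := Real.sqrt_pos.mpr hpos
  have e : (1 : ℂ) + x * Complex.I = Complex.exp
      ((log (1 + x ^ 2) / 2 : ℝ) + (arctan x : ℝ) * Complex.I) := by
    rw [Complex.exp_add_mul_I, ← Complex.ofReal_exp, ← Complex.ofReal_cos, ← Complex.ofReal_sin,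
      ← Real.log_sqrt hpos.le, Real.exp_log hs, Real.cos_arctan, Real.sin_arctan]
    apply Complex.ext
    · simp [hs.ne']
    · simp
      field_simp
  have him : (((log (1 + x ^ 2) / 2 : ℝ) : ℂ) + (arctan x : ℝ) * Complex.I).im = arctan x := by
    simp only [Complex.add_im, Complex.ofReal_im, Complex.mul_im, Complex.ofReal_re, Complex.I_re,
      Complex.I_im]
    ring
  rw [e, Complex.log_exp]
  · rw [him]; linarith [neg_pi_div_two_lt_arctan x, pi_pos]
  · rw [him]; linarith [arctan_lt_pi_div_two x, pi_pos]

/-- The primitive of `arctan x * log (1 + x ^ 2) / x` on `[0, 1]` that vanishes at `0`. -/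
noncomputable def arctanLogPrimitive (x : ℝ) : ℝ := 2 * (landenTrilog (x * Complex.I)).im

/-- The inverse tangent integral, the primitive of `arctan x / x` that vanishes at `0`. -/
noncomputable def arctanIntegral (x : ℝ) : ℝ := -(polyLog 2 (-(x * Complex.I))).im

theorem arctanLogPrimitive_zero : arctanLogPrimitive 0 = 0 := by
  simp [arctanLogPrimitive, landenTrilog, polyLog_zero_right]

theorem arctanIntegral_zero : arctanIntegral 0 = 0 := by
  simp [arctanIntegral, polyLog_zero_right]

theorem continuousOn_arctanLogPrimitive : ContinuousOn arctanLogPrimitive (Icc 0 1) :=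
  continuousOn_const.mul (Complex.continuous_im.comp_continuousOn continuousOn_landenTrilog)

theorem continuousOn_arctanIntegral : ContinuousOn arctanIntegral (Icc 0 1) :=
  (Complex.continuous_im.comp_continuousOn (continuousOn_polyLog_neg_mul_I le_rfl)).neg

theorem HasDerivAt.complex_im {f : ℝ → ℂ} {f' : ℂ} {x : ℝ} (h : HasDerivAt f f' x) :
    HasDerivAt (fun t => (f t).im) f'.im x :=
  Complex.imCLM.hasFDerivAt.comp_hasDerivAt x h

theorem hasDerivAt_arctanLogPrimitive {x : ℝ} (hx : x ∈ Ioo (0 : ℝ) 1) :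
    HasDerivAt arctanLogPrimitive (arctan x * log (1 + x ^ 2) / x) x := by
  refine ((hasDerivAt_landenTrilog hx).complex_im.const_mul 2).congr_deriv ?_
  have h0 := hx.1.ne'
  rw [log_one_add_mul_I, ← Complex.ofReal_ofNat, ← Complex.ofReal_mul, Complex.div_ofReal_im, sq]
  simp only [Complex.mul_im, Complex.add_im, Complex.add_re, Complex.ofReal_re, Complex.ofReal_im,
    Complex.mul_re, Complex.I_re, Complex.I_im]
  field_simp
  ring

theorem hasDerivAt_arctanIntegral {x : ℝ} (hx : x ∈ Ioo (0 : ℝ) 1) :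
    HasDerivAt arctanIntegral (arctan x / x) x := by
  have hz : ‖(x : ℂ) * Complex.I‖ < 1 := by simpa [abs_of_pos hx.1] using hx.2
  have hx0 : (x : ℂ) ≠ 0 := by exact_mod_cast hx.1.ne'
  have hz0 : (x : ℂ) * Complex.I ≠ 0 := mul_ne_zero hx0 Complex.I_ne_zero
  refine (hasDerivAt_polyLog_neg 1 hz hz0).comp_ofReal_mul_I.complex_im.fun_neg.congr_deriv ?_
  rw [polyLog_one_eq (by simpa using hz), sub_neg_eq_add, log_one_add_mul_I]
  have hI := Complex.I_ne_zero
  have e : ∀ w : ℂ, -w / (x * Complex.I) * Complex.I = -w / x := fun w => by field_simp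
  rw [e, Complex.div_ofReal_im]
  simp only [Complex.neg_im, Complex.mul_im, Complex.add_im, Complex.ofReal_re, Complex.ofReal_im,
    Complex.I_re, Complex.I_im]
  ring

/-! ### Polylogarithm values at -i and the value of the primitive at 1 -/

theorem neg_I_pow (n : ℕ) :
    (-Complex.I) ^ n = (cos (π * n / 2) : ℝ) - (sin (π * n / 2) : ℝ) * Complex.I := by
  have h : -Complex.I = Complex.exp (((-(π / 2) : ℝ) : ℂ) * Complex.I) := by
    rw [Complex.exp_mul_I, ← Complex.ofReal_cos, ← Complex.ofReal_sin]
    simp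
  rw [h, ← Complex.exp_nat_mul]
  have e : (n : ℂ) * (((-(π / 2) : ℝ) : ℂ) * Complex.I) = ((-(π * n / 2) : ℝ) : ℂ) * Complex.I := by
    push_cast; ring
  rw [e, Complex.exp_mul_I, ← Complex.ofReal_cos, ← Complex.ofReal_sin, Real.cos_neg, Real.sin_neg]
  push_cast
  ring

theorem polyLog_neg_I_term (s k : ℕ) :
    (-Complex.I) ^ (k + 1) / ((k : ℂ) + 1) ^ s =
      (1 / ((k + 1 : ℕ) : ℝ) ^ s * cos (π * (k + 1 : ℕ) / 2) : ℝ) -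
        (1 / ((k + 1 : ℕ) : ℝ) ^ s * sin (π * (k + 1 : ℕ) / 2) : ℝ) * Complex.I := by
  rw [neg_I_pow]
  push_cast
  ring

theorem hasSum_im_polyLog_neg_I {s : ℕ} (hs : 2 ≤ s) :
    HasSum (fun k : ℕ => 1 / ((k + 1 : ℕ) : ℝ) ^ s * sin (π * (k + 1 : ℕ) / 2))
      (-(polyLog s (-Complex.I)).im) := by
  refine (Complex.hasSum_im (hasSum_polyLog hs (z := -Complex.I) (by simp))).neg.congr_fun
    fun k => ?_
  rw [polyLog_neg_I_term]
  simp only [Complex.sub_im, Complex.ofReal_im, Complex.mul_im, Complex.ofReal_re, Complex.I_re,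
    Complex.I_im]
  ring

theorem hasSum_re_polyLog_neg_I {s : ℕ} (hs : 2 ≤ s) :
    HasSum (fun k : ℕ => 1 / ((k + 1 : ℕ) : ℝ) ^ s * cos (π * (k + 1 : ℕ) / 2))
      (polyLog s (-Complex.I)).re := by
  refine (Complex.hasSum_re (hasSum_polyLog hs (z := -Complex.I) (by simp))).congr_fun
    fun k => ?_
  rw [polyLog_neg_I_term]
  simp only [Complex.sub_re, Complex.ofReal_im, Complex.mul_re, Complex.ofReal_re, Complex.I_re,
    Complex.I_im]
  ring

/-- The series is minus the Dirichlet L-series mod 4 at 3, whose value is π³/32. -/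
theorem polyLog_three_neg_I_im : (polyLog 3 (-Complex.I)).im = -(π ^ 3 / 32) := by
  have h := (hasSum_nat_add_iff' 1).mpr hasSum_L_function_mod_four_eval_three
  have h2 := h.unique (by simpa using hasSum_im_polyLog_neg_I (s := 3) (by norm_num))
  simp at h2
  linarith

/-- The cosine series is the Fourier expansion of the second Bernoulli polynomial, taken at 1/4. -/
theorem polyLog_two_neg_I_re : (polyLog 2 (-Complex.I)).re = -(π ^ 2 / 48) := by
  have h0 := hasSum_one_div_nat_pow_mul_cos (k := 1) one_ne_zero
    (show (1 / 4 : ℝ) ∈ Icc (0 : ℝ) 1 by constructor <;> norm_num)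
  have e : ∀ n : ℕ, 2 * π * n * (1 / 4) = π * n / 2 := fun n => by ring
  simp only [e] at h0
  have h := (hasSum_nat_add_iff' 1).mpr h0
  have h2 := h.unique (hasSum_re_polyLog_neg_I (s := 2) le_rfl)
  rw [← h2]
  have h14 : (1 / 4 : ℝ) = (algebraMap ℚ ℝ) (1 / 4 : ℚ) := by simp
  rw [h14, Polynomial.eval_map, Polynomial.eval₂_at_apply, Polynomial.bernoulli_def]
  norm_num [Finset.sum_range_succ, Nat.factorial, bernoulli_two, bernoulli_one, bernoulli_zero,
    Polynomial.eval_add, Nat.choose]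
  ring

theorem polyLog_two_neg_I_im : (polyLog 2 (-Complex.I)).im = -catalanConstant := by
  have h := hasSum_im_polyLog_neg_I (s := 2) le_rfl
  -- The index k stands for the exponent k + 1, so the even k carry the odd exponents; the other
  -- sines vanish.
  have hinj : Function.Injective fun m : ℕ => 2 * m := fun a b hab => by simpa using hab
  rw [← hinj.hasSum_iff] at h
  · have h2 : HasSum (fun n : ℕ => (-1 : ℝ) ^ n / (2 * (n : ℝ) + 1) ^ 2)
        (-(polyLog 2 (-Complex.I)).im) := by
      refine h.congr_fun fun n => ?_
      have e : π * ((2 * n + 1 : ℕ) : ℝ) / 2 = π / 2 + n * π := by push_cast; ring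
      simp only [Function.comp_apply]
      rw [e, sin_add_nat_mul_pi, sin_pi_div_two]
      push_cast
      ring
    rw [catalanConstant, h2.tsum_eq, neg_neg]
  · intro k hk
    rcases Nat.even_or_odd' k with ⟨m, rfl | rfl⟩
    · exact absurd ⟨m, rfl⟩ hk
    · have e : π * ((2 * m + 1 + 1 : ℕ) : ℝ) / 2 = (m + 1 : ℕ) * π := by push_cast; ring
      rw [e, sin_nat_mul_pi, mul_zero]

theorem arctanIntegral_one : arctanIntegral 1 = catalanConstant := by
  simp [arctanIntegral, polyLog_two_neg_I_im]

theorem arctanLogPrimitive_one :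
    arctanLogPrimitive 1 = 2 * (polyLog 3 ((1 + Complex.I) / 2)).im - 3 * π ^ 3 / 64
      - π * log 2 ^ 2 / 16 + catalanConstant * log 2 := by
  have e1 : Complex.I / (1 + Complex.I) = (1 + Complex.I) / 2 := by
    have : (1 : ℂ) + Complex.I ≠ 0 := by simpa using one_add_ofReal_mul_I_ne_zero 1
    field_simp
    linear_combination -Complex.I_sq
  have e2 := log_one_add_mul_I 1
  rw [Complex.ofReal_one, one_mul, arctan_one, one_pow, one_add_one_eq_two] at e2
  have e3 : (Complex.log (1 + Complex.I)).re = log 2 / 2 := by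
    rw [e2, Complex.add_re, Complex.re_ofReal_mul, Complex.I_re, mul_zero, add_zero,
      Complex.ofReal_re]
  have e4 : (Complex.log (1 + Complex.I)).im = π / 4 := by
    rw [e2, Complex.add_im, Complex.im_ofReal_mul, Complex.I_im, mul_one, Complex.ofReal_im,
      zero_add]
  rw [arctanLogPrimitive, landenTrilog, Complex.ofReal_one, one_mul, e1]
  have e5 : ((6 : ℝ) : ℂ) = 6 := by norm_num
  rw [← e5, Complex.sub_im, Complex.div_ofReal_im, Complex.sub_im, Complex.add_im, Complex.mul_im,
    pow_succ, sq, Complex.mul_im, Complex.mul_im, Complex.mul_re, e3, e4, polyLog_three_neg_I_im,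
    polyLog_two_neg_I_im, polyLog_two_neg_I_re]
  ring

/-! ### Integrable majorants with logarithmic singularities -/

theorem intervalIntegrable_log_sq {b : ℝ} (hb : 0 ≤ b) :
    IntervalIntegrable (fun x => log x ^ 2) volume 0 b := by
  -- This is the primitive x log² x - 2x log x + 2x; writing x log² x as 4(√x log √x)² makes
  -- continuity at 0 follow from that of y log y.
  have hc : ContinuousOn (fun x : ℝ => 4 * (√x * log √x) ^ 2 - 2 * (x * log x) + 2 * x)
      (uIcc 0 b) := by
    have h1 : Continuous fun x : ℝ => √x * log √x :=
      Real.continuous_mul_log.comp Real.continuous_sqrt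
    have h2 := Real.continuous_mul_log
    fun_prop
  refine intervalIntegral.intervalIntegrable_deriv_of_nonneg hc ?_ fun x _ => sq_nonneg _
  intro x hx
  rw [min_eq_left hb, max_eq_right hb] at hx
  have hl := Real.hasDerivAt_log hx.1.ne'
  have h := (((hasDerivAt_id x).fun_mul (hl.fun_pow 2)).fun_sub
    (((hasDerivAt_id x).fun_mul hl).const_mul 2)).fun_add ((hasDerivAt_id x).const_mul 2)
  refine (h.congr_of_eventuallyEq ?_).congr_deriv ?_
  · filter_upwards [lt_mem_nhds hx.1] with y hy
    simp only [id]
    rw [Real.log_sqrt hy.le, mul_pow, Real.sq_sqrt hy.le]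
    ring
  · have := hx.1.ne'
    simp only [id]
    field_simp
    push_cast
    ring

theorem intervalIntegrable_abs_log_add_sq (C : ℝ) {b : ℝ} (hb : 0 ≤ b) :
    IntervalIntegrable (fun x => (|log x| + C) ^ 2) volume 0 b := by
  have h1 : IntervalIntegrable (fun x => |log x|) volume 0 b :=
    intervalIntegral.intervalIntegrable_log'.abs
  have h2 := ((intervalIntegrable_log_sq hb).add (h1.const_mul (2 * C))).add
    (intervalIntegrable_const (c := C ^ 2))
  refine h2.congr fun x _ => ?_
  change log x ^ 2 + 2 * C * |log x| + C ^ 2 = (|log x| + C) ^ 2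
  rw [add_sq, sq_abs]
  ring

theorem neg_log_sin_le {x : ℝ} (hx : x ∈ Ioo 0 (π / 2)) :
    -log (sin x) ≤ |log x| + log (π / 2) := by
  have h1 : 2 / π * x ≤ sin x := mul_le_sin hx.1.le hx.2.le
  have h2 : 0 < 2 / π * x := by have := hx.1; positivity
  have h3 := Real.log_le_log h2 h1
  rw [Real.log_mul (by positivity) hx.1.ne'] at h3
  have h4 : log (2 / π) = -log (π / 2) := by rw [← Real.log_inv, inv_div]
  have h5 := neg_abs_le (log x)
  linarith

/-! ### The contour integral on a quarter disc of radius r < 1 -/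

/-- The function `log ((1 - z) / (1 + z))`. -/
noncomputable def logRatio (z : ℂ) : ℂ := Complex.log (1 - z) - Complex.log (1 + z)

/-- The second factor of the integrand of the contour integral. -/
noncomputable def contourFactor (z : ℂ) : ℂ :=
  logRatio z + 4 * Complex.log (1 + z) - 4 * (log 2 : ℝ)

theorem differentiableAt_logRatio {z : ℂ} (h1 : 1 - z ∈ Complex.slitPlane)
    (h2 : 1 + z ∈ Complex.slitPlane) : DifferentiableAt ℂ logRatio z :=
  (DifferentiableAt.clog (by fun_prop) h1).sub (DifferentiableAt.clog (by fun_prop) h2)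

theorem differentiableAt_contourFactor {z : ℂ} (h1 : 1 - z ∈ Complex.slitPlane)
    (h2 : 1 + z ∈ Complex.slitPlane) : DifferentiableAt ℂ contourFactor z :=
  ((differentiableAt_logRatio h1 h2).add
    ((DifferentiableAt.clog (by fun_prop) h2).const_mul 4)).sub_const _

theorem one_sub_mem_slitPlane_of_norm_lt {z : ℂ} (hz : ‖z‖ < 1) : 1 - z ∈ Complex.slitPlane := by
  simpa [sub_eq_add_neg] using Complex.mem_slitPlane_of_norm_lt_one (z := -z) (by simpa using hz)

theorem one_add_mem_slitPlane_of_norm_lt {z : ℂ} (hz : ‖z‖ < 1) : 1 + z ∈ Complex.slitPlane :=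
  Complex.mem_slitPlane_of_norm_lt_one hz

theorem logRatio_zero : logRatio 0 = 0 := by simp [logRatio]

/-- `dslope` removes the singularity of `logRatio z / z` at 0, so the integrand is holomorphic on
the disc and has a primitive; Cauchy's theorem becomes a comparison of its values at the ends of
each path. -/
theorem exists_contour_primitive : ∃ F : ℂ → ℂ, F 0 = 0 ∧ ∀ z : ℂ, ‖z‖ < 1 →
    HasDerivAt F (dslope logRatio 0 z * contourFactor z) z := by
  have h1 : DifferentiableOn ℂ logRatio (Metric.ball 0 1) := fun z hz => by
    have hz' : ‖z‖ < 1 := by simpa using hz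
    exact (differentiableAt_logRatio (one_sub_mem_slitPlane_of_norm_lt hz')
      (one_add_mem_slitPlane_of_norm_lt hz')).differentiableWithinAt
  have h2 : DifferentiableOn ℂ contourFactor (Metric.ball 0 1) := fun z hz => by
    have hz' : ‖z‖ < 1 := by simpa using hz
    exact (differentiableAt_contourFactor (one_sub_mem_slitPlane_of_norm_lt hz')
      (one_add_mem_slitPlane_of_norm_lt hz')).differentiableWithinAt
  have h3 : DifferentiableOn ℂ (dslope logRatio 0) (Metric.ball 0 1) :=
    (Complex.differentiableOn_dslope (Metric.ball_mem_nhds _ one_pos)).mpr h1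
  obtain ⟨F, hF0, hF⟩ := (h3.mul h2).isExactOn_ball.with_val_at 0 0
  exact ⟨F, hF0, fun z hz => hF z (by simpa using hz)⟩

theorem dslope_logRatio {z : ℂ} (hz : z ≠ 0) : dslope logRatio 0 z = logRatio z / z := by
  rw [dslope_of_ne _ hz, slope_def_field, logRatio_zero, sub_zero, sub_zero]

theorem eq_of_hasDerivAt_zero_of_continuousOn {f : ℝ → ℝ} {a b : ℝ} (hab : a ≤ b)
    (hc : ContinuousOn f (Icc a b)) (hd : ∀ x ∈ Ioo a b, HasDerivAt f 0 x) : f b = f a := by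
  have h := intervalIntegral.integral_eq_sub_of_hasDerivAt_of_le (f' := fun _ => (0 : ℝ)) hab hc hd
    (by simp)
  rw [intervalIntegral.integral_zero] at h
  linarith

theorem contour_primitive_im_ofReal {F : ℂ → ℂ} (hF0 : F 0 = 0)
    (hF : ∀ z : ℂ, ‖z‖ < 1 → HasDerivAt F (dslope logRatio 0 z * contourFactor z) z)
    {r : ℝ} (hr0 : 0 ≤ r) (hr : r < 1) : (F r).im = 0 := by
  have hn : ∀ t ∈ Icc 0 r, ‖(t : ℂ)‖ < 1 := fun t ht => by
    simpa [abs_of_nonneg ht.1] using ht.2.trans_lt hr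
  have hd : ∀ t ∈ Icc 0 r, HasDerivAt (fun t : ℝ => (F t).im)
      (dslope logRatio 0 (t : ℂ) * contourFactor t).im t := fun t ht =>
    (hF t (hn t ht)).comp_ofReal.complex_im
  have h := eq_of_hasDerivAt_zero_of_continuousOn hr0
    (fun t ht => (hd t ht).continuousAt.continuousWithinAt) fun t ht => by
      refine (hd t (Ioo_subset_Icc_self ht)).congr_deriv ?_
      have ht0 : (t : ℂ) ≠ 0 := by exact_mod_cast ht.1.ne'
      have e1 : Complex.log (1 - t) = (log (1 - t) : ℝ) := by
        rw [Complex.ofReal_log (by linarith [ht.2])]; push_cast; rfl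
      have e2 : Complex.log (1 + t) = (log (1 + t) : ℝ) := by
        rw [Complex.ofReal_log (by linarith [ht.1])]; push_cast; rfl
      rw [dslope_logRatio ht0, contourFactor, logRatio, e1, e2]
      norm_cast
  simpa [hF0] using h

theorem log_one_sub_mul_I (x : ℝ) :
    Complex.log (1 - x * Complex.I) = (log (1 + x ^ 2) / 2 : ℝ) - (arctan x : ℝ) * Complex.I := by
  have h := log_one_add_mul_I (-x)
  rw [arctan_neg, neg_sq] at h
  push_cast at h ⊢
  rw [sub_eq_add_neg, ← neg_mul, h]
  ring

/-- At z = it, `logRatio` is -2i arctan t, so only the real part of the other factor, 2 log(1+t²) -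
4 log 2, enters the imaginary part of the product. -/
theorem contour_primitive_im_mul_I {F : ℂ → ℂ} (hF0 : F 0 = 0)
    (hF : ∀ z : ℂ, ‖z‖ < 1 → HasDerivAt F (dslope logRatio 0 z * contourFactor z) z)
    {r : ℝ} (hr0 : 0 ≤ r) (hr : r < 1) :
    (F (r * Complex.I)).im = -4 * arctanLogPrimitive r + 8 * log 2 * arctanIntegral r := by
  have hn : ∀ t ∈ Icc 0 r, ‖(t : ℂ) * Complex.I‖ < 1 := fun t ht => by
    simpa [abs_of_nonneg ht.1] using ht.2.trans_lt hr
  have hd : ∀ t ∈ Icc 0 r, HasDerivAt (fun t : ℝ => (F (t * Complex.I)).im)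
      (dslope logRatio 0 (t * Complex.I) * contourFactor (t * Complex.I) * Complex.I).im t :=
    fun t ht => (hF _ (hn t ht)).comp_ofReal_mul_I.complex_im
  have hsub : Icc 0 r ⊆ Icc (0 : ℝ) 1 := Icc_subset_Icc_right hr.le
  have h := eq_of_hasDerivAt_zero_of_continuousOn hr0 (f := fun t => (F (t * Complex.I)).im -
      (-4 * arctanLogPrimitive t + 8 * log 2 * arctanIntegral t))
    (ContinuousOn.sub (fun t ht => (hd t ht).continuousAt.continuousWithinAt)
      ((continuousOn_const.mul (continuousOn_arctanLogPrimitive.mono hsub)).add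
        (continuousOn_const.mul (continuousOn_arctanIntegral.mono hsub)))) fun t ht => by
      have ht1 : t ∈ Ioo (0 : ℝ) 1 := ⟨ht.1, ht.2.trans hr⟩
      refine ((hd t (Ioo_subset_Icc_self ht)).fun_sub
        (((hasDerivAt_arctanLogPrimitive ht1).const_mul (-4)).fun_add
          ((hasDerivAt_arctanIntegral ht1).const_mul (8 * log 2)))).congr_deriv ?_
      have ht0 : (t : ℂ) ≠ 0 := by exact_mod_cast ht.1.ne'
      have hI := Complex.I_ne_zero
      rw [dslope_logRatio (mul_ne_zero ht0 hI)]
      have e : logRatio (t * Complex.I) / (t * Complex.I) * contourFactor (t * Complex.I)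
          * Complex.I = logRatio (t * Complex.I) * contourFactor (t * Complex.I) / t := by
        field_simp
      rw [e, Complex.div_ofReal_im, contourFactor, logRatio, log_one_sub_mul_I, log_one_add_mul_I]
      have ht0' := ht.1.ne'
      have e4 : (4 : ℂ) = ((4 : ℝ) : ℂ) := by norm_num
      rw [e4]
      simp only [Complex.mul_im, Complex.add_im, Complex.sub_im, Complex.ofReal_im,
        Complex.ofReal_re, Complex.mul_re, Complex.add_re, Complex.sub_re, Complex.I_re,
        Complex.I_im]
      field_simp
      ring
  simp only [Complex.ofReal_zero, zero_mul, hF0, Complex.zero_im, arctanLogPrimitive_zero,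
    arctanIntegral_zero] at h
  linarith

theorem continuous_arc_re {r : ℝ} (hr0 : 0 < r) (hr : r < 1) :
    Continuous fun ω : ℝ => (logRatio (r * Complex.exp (ω * Complex.I)) *
        contourFactor (r * Complex.exp (ω * Complex.I))).re := by
  have hz : Continuous fun ω : ℝ => (r : ℂ) * Complex.exp (ω * Complex.I) := by fun_prop
  refine Complex.continuous_re.comp (continuous_iff_continuousAt.mpr fun ω => ?_)
  have hn : ‖(r : ℂ) * Complex.exp (ω * Complex.I)‖ < 1 := by
    simpa [Complex.norm_exp_ofReal_mul_I, abs_of_pos hr0] using hr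
  have ha := one_sub_mem_slitPlane_of_norm_lt hn
  have hb := one_add_mem_slitPlane_of_norm_lt hn
  exact (ContinuousAt.comp (f := fun ω : ℝ => (r : ℂ) * Complex.exp (ω * Complex.I))
    (differentiableAt_logRatio ha hb).continuousAt hz.continuousAt).mul
    (ContinuousAt.comp (f := fun ω : ℝ => (r : ℂ) * Complex.exp (ω * Complex.I))
    (differentiableAt_contourFactor ha hb).continuousAt hz.continuousAt)

/-- On the arc dz/z = i dω, so the change of Im F is the integral of the real part. It runs from r,
where Im F = 0, to ir. -/
theorem integral_arc_re {r : ℝ} (hr0 : 0 < r) (hr : r < 1) :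
    ∫ ω in (0 : ℝ)..(π / 2), (logRatio (r * Complex.exp (ω * Complex.I)) *
        contourFactor (r * Complex.exp (ω * Complex.I))).re =
      -4 * arctanLogPrimitive r + 8 * log 2 * arctanIntegral r := by
  obtain ⟨F, hF0, hF⟩ := exists_contour_primitive
  have hn : ∀ ω : ℝ, ‖(r : ℂ) * Complex.exp (ω * Complex.I)‖ < 1 := fun ω => by
    simpa [Complex.norm_exp_ofReal_mul_I, abs_of_pos hr0] using hr
  have hr' : (r : ℂ) ≠ 0 := by exact_mod_cast hr0.ne'
  have hd : ∀ ω : ℝ, HasDerivAt (fun ω : ℝ => (F (r * Complex.exp (ω * Complex.I))).im)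
      (logRatio (r * Complex.exp (ω * Complex.I)) *
        contourFactor (r * Complex.exp (ω * Complex.I))).re ω := fun ω => by
    have h1 : HasDerivAt (fun w : ℂ => (r : ℂ) * Complex.exp (w * Complex.I))
        (r * (Complex.exp (ω * Complex.I) * Complex.I)) (ω : ℂ) := by
      have h2 := ((hasDerivAt_id (ω : ℂ)).mul_const Complex.I).cexp.const_mul (r : ℂ)
      simpa using h2
    have h3 := (HasDerivAt.comp (ω : ℂ) (hF _ (hn ω)) h1).comp_ofReal.complex_im
    refine h3.congr_deriv ?_
    have he : Complex.exp (ω * Complex.I) ≠ 0 := Complex.exp_ne_zero _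
    rw [dslope_logRatio (mul_ne_zero hr' he)]
    set z := Complex.exp (ω * Complex.I)
    have e : logRatio (r * z) / (r * z) * contourFactor (r * z) * (r * (z * Complex.I)) =
        logRatio (r * z) * contourFactor (r * z) * Complex.I := by
      field_simp
    rw [e, Complex.mul_I_im]
  rw [intervalIntegral.integral_eq_sub_of_hasDerivAt (fun ω _ => hd ω)
    ((continuous_arc_re hr0 hr).intervalIntegrable _ _)]
  have e : Complex.exp (((π / 2 : ℝ) : ℂ) * Complex.I) = Complex.I := by
    push_cast; exact Complex.exp_pi_div_two_mul_I
  rw [e, contour_primitive_im_mul_I hF0 hF hr0.le hr]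
  simp [contour_primitive_im_ofReal hF0 hF hr0.le hr]

/-! ### Passage to the unit arc -/

theorem norm_clog_le {z : ℂ} {a : ℝ} (h0 : 0 < a) (ha : a ≤ 1) (h1 : a ≤ ‖z‖) (h2 : ‖z‖ ≤ 2) :
    ‖Complex.log z‖ ≤ -log a + (log 2 + π) := by
  have h3 : ‖Complex.log z‖ ≤ |(Complex.log z).re| + |(Complex.log z).im| :=
    Complex.norm_le_abs_re_add_abs_im _
  rw [Complex.log_re, Complex.log_im] at h3
  have h4 := Complex.abs_arg_le_pi z
  have h5 := Real.log_le_log h0 h1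
  have h6 := Real.log_le_log (h0.trans_le h1) h2
  have h7 := Real.log_nonpos h0.le ha
  have h8 : 0 ≤ log 2 := Real.log_nonneg one_le_two
  have h9 : |log ‖z‖| ≤ -log a + log 2 := abs_le.mpr ⟨by linarith, by linarith⟩
  linarith

/-- A majorant independent of r: |1-z| ≥ sin ω, because |1-z|² - sin² ω = (r - cos ω)², and |1+z| ≥
1. With M = log 2 + π, the first factor costs 2M; the second adds at most 4M for 4 log(1+z) and 4M
for 4 log 2, hence the 10. -/
theorem norm_logRatio_mul_contourFactor_le {r ω : ℝ} (hr0 : 0 < r) (hr : r < 1)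
    (hω : ω ∈ Ioo 0 (π / 2)) :
    ‖logRatio (r * Complex.exp (ω * Complex.I)) *
        contourFactor (r * Complex.exp (ω * Complex.I))‖ ≤
      (|log ω| + (log (π / 2) + 10 * (log 2 + π))) ^ 2 := by
  have hs : 0 < sin ω := sin_pos_of_pos_of_lt_pi hω.1 (by linarith [hω.2, pi_pos])
  have hc : 0 < cos ω := cos_pos_of_mem_Ioo ⟨by linarith [hω.1, pi_pos], hω.2⟩
  have hsc := sin_sq_add_cos_sq ω
  have hz : (r : ℂ) * Complex.exp (ω * Complex.I) = ⟨r * cos ω, r * sin ω⟩ := by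
    apply Complex.ext
    · rw [Complex.re_ofReal_mul, Complex.exp_ofReal_mul_I_re]
    · rw [Complex.im_ofReal_mul, Complex.exp_ofReal_mul_I_im]
  have hn : ‖(r : ℂ) * Complex.exp (ω * Complex.I)‖ = r := by
    simp [Complex.norm_exp_ofReal_mul_I, abs_of_pos hr0]
  set z := (r : ℂ) * Complex.exp (ω * Complex.I)
  have h1 : ‖1 - z‖ ≤ 2 := (norm_sub_le _ _).trans (by rw [hn, norm_one]; linarith)
  have h2 : ‖1 + z‖ ≤ 2 := (norm_add_le _ _).trans (by rw [hn, norm_one]; linarith)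
  have h3 : sin ω ≤ ‖1 - z‖ := by
    refine le_of_sq_le_sq ?_ (norm_nonneg _)
    rw [Complex.sq_norm, Complex.normSq_apply, hz]
    simp only [Complex.sub_re, Complex.one_re, Complex.sub_im, Complex.one_im]
    nlinarith [sq_nonneg (r - cos ω)]
  have h4 : 1 ≤ ‖1 + z‖ := by
    have := Complex.re_le_norm (1 + z)
    rw [hz] at this ⊢
    simp only [Complex.add_re, Complex.one_re] at this
    nlinarith [mul_pos hr0 hc]
  have h5 := norm_clog_le hs (sin_le_one ω) h3 h1
  have h6 := norm_clog_le one_pos le_rfl h4 h2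
  rw [Real.log_one, neg_zero, zero_add] at h6
  have h7 := neg_log_sin_le hω
  have hl2 : 0 ≤ log 2 := Real.log_nonneg one_le_two
  have hpi := pi_pos
  have hA : ‖logRatio z‖ ≤ |log ω| + (log (π / 2) + 2 * (log 2 + π)) := by
    have := norm_sub_le (Complex.log (1 - z)) (Complex.log (1 + z))
    rw [logRatio]; linarith
  have hB : ‖contourFactor z‖ ≤ |log ω| + (log (π / 2) + 10 * (log 2 + π)) := by
    have a1 := norm_sub_le (logRatio z + 4 * Complex.log (1 + z)) (4 * (log 2 : ℝ))
    have a2 := norm_add_le (logRatio z) (4 * Complex.log (1 + z))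
    have a3 : ‖4 * Complex.log (1 + z)‖ = 4 * ‖Complex.log (1 + z)‖ := by simp
    have a4 : ‖(4 : ℂ) * (log 2 : ℝ)‖ = 4 * log 2 := by
      rw [norm_mul, Complex.norm_real, Real.norm_of_nonneg hl2]; simp
    rw [contourFactor]; linarith
  have hA' : ‖logRatio z‖ ≤ |log ω| + (log (π / 2) + 10 * (log 2 + π)) := by linarith
  rw [norm_mul, sq]
  exact mul_le_mul hA' hB (norm_nonneg _) ((norm_nonneg _).trans hA')

/-- Half-angle form: 1 + e^(iω) = 2 cos(ω/2) e^(iω/2), with argument in the principal range. -/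
theorem log_one_add_exp {ω : ℝ} (hω : ω ∈ Ioo 0 (π / 2)) :
    Complex.log (1 + Complex.exp (ω * Complex.I)) =
      (log 2 + log (cos (ω / 2)) : ℝ) + (ω / 2 : ℝ) * Complex.I := by
  have hc : 0 < cos (ω / 2) := cos_pos_of_mem_Ioo ⟨by linarith [hω.1, pi_pos], by linarith [hω.1, hω.2]⟩
  have e : 1 + Complex.exp (ω * Complex.I) =
      Complex.exp ((log 2 + log (cos (ω / 2)) : ℝ) + (ω / 2 : ℝ) * Complex.I) := by
    rw [Complex.exp_add_mul_I, ← Complex.ofReal_exp, ← Complex.ofReal_cos, ← Complex.ofReal_sin,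
      Real.exp_add, Real.exp_log two_pos, Real.exp_log hc]
    have h2 : ω = 2 * (ω / 2) := by ring
    apply Complex.ext
    · rw [Complex.re_ofReal_mul, Complex.add_re, Complex.exp_ofReal_mul_I_re]
      nth_rewrite 1 [h2]
      rw [cos_two_mul]
      simp only [Complex.one_re, Complex.add_re, Complex.ofReal_re, Complex.re_ofReal_mul,
        Complex.I_re]
      ring
    · rw [Complex.im_ofReal_mul, Complex.add_im, Complex.exp_ofReal_mul_I_im]
      nth_rewrite 1 [h2]
      rw [sin_two_mul]
      simp only [Complex.one_im, Complex.add_im, Complex.ofReal_im, Complex.im_ofReal_mul,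
        Complex.I_im]
      ring
  rw [e, Complex.log_exp] <;>
  · simp only [Complex.add_im, Complex.ofReal_im, Complex.im_ofReal_mul, Complex.I_im]
    linarith [hω.1, hω.2, pi_pos]

/-- Half-angle form: 1 - e^(iω) = 2 sin(ω/2) e^(i(ω/2 - π/2)). -/
theorem log_one_sub_exp {ω : ℝ} (hω : ω ∈ Ioo 0 (π / 2)) :
    Complex.log (1 - Complex.exp (ω * Complex.I)) =
      (log 2 + log (sin (ω / 2)) : ℝ) + (ω / 2 - π / 2 : ℝ) * Complex.I := by
  have hc : 0 < sin (ω / 2) :=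
    sin_pos_of_pos_of_lt_pi (by linarith [hω.1]) (by linarith [hω.2, pi_pos])
  have e : 1 - Complex.exp (ω * Complex.I) =
      Complex.exp ((log 2 + log (sin (ω / 2)) : ℝ) + (ω / 2 - π / 2 : ℝ) * Complex.I) := by
    rw [Complex.exp_add_mul_I, ← Complex.ofReal_exp, ← Complex.ofReal_cos, ← Complex.ofReal_sin,
      Real.exp_add, Real.exp_log two_pos, Real.exp_log hc, cos_sub_pi_div_two, sin_sub_pi_div_two]
    have h2 : ω = 2 * (ω / 2) := by ring
    apply Complex.ext
    · rw [Complex.re_ofReal_mul, Complex.sub_re, Complex.exp_ofReal_mul_I_re]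
      nth_rewrite 1 [h2]
      rw [cos_two_mul, cos_sq']
      simp only [Complex.one_re, Complex.add_re, Complex.ofReal_re, Complex.re_ofReal_mul,
        Complex.I_re]
      ring
    · rw [Complex.im_ofReal_mul, Complex.sub_im, Complex.exp_ofReal_mul_I_im]
      nth_rewrite 1 [h2]
      rw [sin_two_mul]
      simp only [Complex.one_im, Complex.add_im, Complex.ofReal_im, Complex.im_ofReal_mul,
        Complex.I_im]
      ring
  rw [e, Complex.log_exp] <;>
  · simp only [Complex.add_im, Complex.ofReal_im, Complex.im_ofReal_mul, Complex.I_im]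
    linarith [hω.1, hω.2, pi_pos]

theorem log_tan_eq {x : ℝ} (hx : x ∈ Ioo 0 (π / 2)) :
    log (tan x) = log (sin x) - log (cos x) := by
  have hs : 0 < sin x := sin_pos_of_pos_of_lt_pi hx.1 (by linarith [hx.2, pi_pos])
  have hc : 0 < cos x := cos_pos_of_mem_Ioo ⟨by linarith [hx.1, pi_pos], hx.2⟩
  rw [tan_eq_sin_div_cos, Real.log_div (ne_of_gt hs) (ne_of_gt hc)]

/-- The integrand `log² tan (θ / 2) + 4 log cos (θ / 2) log tan (θ / 2)`. -/
noncomputable def logTanQuadratic (θ : ℝ) : ℝ :=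
  log (tan (θ / 2)) ^ 2 + 4 * log (cos (θ / 2)) * log (tan (θ / 2))

/-- The factors are L - iπ/2 and L + 4 log cos(ω/2) + i(2ω - π/2), with L = log tan(ω/2). The
constant -4 log 2 in `contourFactor` cancels the log 2 from |1 + e^(iω)|. -/
theorem re_logRatio_mul_contourFactor_exp {ω : ℝ} (hω : ω ∈ Ioo 0 (π / 2)) :
    (logRatio (Complex.exp (ω * Complex.I)) * contourFactor (Complex.exp (ω * Complex.I))).re =
      logTanQuadratic ω + (π * ω - π ^ 2 / 4) := by
  have e4 : (4 : ℂ) = ((4 : ℝ) : ℂ) := by norm_num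
  rw [logTanQuadratic, log_tan_eq ⟨by linarith [hω.1], by linarith [hω.1, hω.2]⟩, contourFactor,
    logRatio, log_one_add_exp hω, log_one_sub_exp hω, e4]
  simp only [Complex.mul_im, Complex.add_im, Complex.sub_im, Complex.ofReal_im,
    Complex.ofReal_re, Complex.mul_re, Complex.add_re, Complex.sub_re, Complex.I_re, Complex.I_im]
  ring

theorem tan_half_mem_Ioo {θ : ℝ} (hθ : θ ∈ Ioo 0 (π / 2)) : tan (θ / 2) ∈ Ioo (0 : ℝ) 1 := by
  refine ⟨tan_pos_of_pos_of_lt_pi_div_two (by linarith [hθ.1]) (by linarith [hθ.1, hθ.2]), ?_⟩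
  rw [← tan_pi_div_four]
  exact strictMonoOn_tan ⟨by linarith [hθ.1, pi_pos], by linarith [hθ.1, hθ.2]⟩
    ⟨by linarith [pi_pos], by linarith [pi_pos]⟩ (by linarith [hθ.2])

theorem log_tan_half_nonpos {θ : ℝ} (hθ : θ ∈ Ioo 0 (π / 2)) : log (tan (θ / 2)) ≤ 0 :=
  Real.log_nonpos (tan_half_mem_Ioo hθ).1.le (tan_half_mem_Ioo hθ).2.le

theorem neg_log_tan_half_le {θ : ℝ} (hθ : θ ∈ Ioo 0 (π / 2)) :
    -log (tan (θ / 2)) ≤ |log θ| + log 2 := by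
  have h1 : θ / 2 < tan (θ / 2) := lt_tan (by linarith [hθ.1]) (by linarith [hθ.1, hθ.2])
  have h2 := Real.log_le_log (by linarith [hθ.1]) h1.le
  rw [Real.log_div hθ.1.ne' two_ne_zero] at h2
  linarith [neg_abs_le (log θ)]

theorem abs_logTanQuadratic_le {θ : ℝ} (hθ : θ ∈ Ioo 0 (π / 2)) :
    |logTanQuadratic θ| ≤ (|log θ| + (log 2 + 4)) ^ 2 := by
  have h0 : 0 < θ / 2 := by linarith [hθ.1]
  have h3 := log_tan_half_nonpos hθ
  have hu := neg_log_tan_half_le hθ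
  have hc : 0 < cos (θ / 2) := cos_pos_of_mem_Ioo ⟨by linarith [hθ.1, pi_pos], by linarith [hθ.1, hθ.2]⟩
  have hc2 : 1 / 2 ≤ cos (θ / 2) := by
    rw [← cos_pi_div_three]
    exact cos_le_cos_of_nonneg_of_le_pi h0.le (by linarith [pi_pos]) (by linarith [hθ.2, pi_pos])
  have h4 := Real.log_le_log (by norm_num) hc2
  rw [one_div, Real.log_inv] at h4
  have h5 := Real.log_nonpos hc.le (cos_le_one _)
  have h6 : log 2 ≤ 1 := by linarith [Real.log_two_lt_d9]
  rw [logTanQuadratic]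
  set l := log (tan (θ / 2))
  set c := log (cos (θ / 2))
  have hcl : 0 ≤ c * l := mul_nonneg_of_nonpos_of_nonpos h5 h3
  rw [abs_of_nonneg (by nlinarith)]
  have hl2 : 0 ≤ log 2 := Real.log_nonneg one_le_two
  nlinarith [abs_nonneg (log θ)]

theorem continuousOn_logTanQuadratic : ContinuousOn logTanQuadratic (Ioo 0 (π / 2)) := by
  intro θ hθ
  have hc : 0 < cos (θ / 2) := cos_pos_of_mem_Ioo ⟨by linarith [hθ.1, pi_pos], by linarith [hθ.1, hθ.2]⟩
  have ht : 0 < tan (θ / 2) :=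
    tan_pos_of_pos_of_lt_pi_div_two (by linarith [hθ.1]) (by linarith [hθ.1, hθ.2])
  have h1 : ContinuousAt (fun θ : ℝ => tan (θ / 2)) θ :=
    ContinuousAt.comp (f := fun θ : ℝ => θ / 2) (continuousAt_tan.mpr hc.ne') (by fun_prop)
  have h2 : ContinuousAt (fun θ : ℝ => cos (θ / 2)) θ := by fun_prop
  have h3 := h1.log ht.ne'
  exact ((h3.pow 2).add ((continuousAt_const.mul (h2.log hc.ne')).mul h3)).continuousWithinAt

theorem intervalIntegrable_of_abs_le {f g : ℝ → ℝ} {a b : ℝ} (hab : a ≤ b)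
    (hg : IntervalIntegrable g volume a b) (hf : ContinuousOn f (Ioo a b))
    (h : ∀ x ∈ Ioo a b, |f x| ≤ g x) : IntervalIntegrable f volume a b := by
  rw [intervalIntegrable_iff_integrableOn_Ioo_of_le hab] at hg ⊢
  refine Integrable.mono' hg (hf.aestronglyMeasurable measurableSet_Ioo) ?_
  exact (ae_restrict_mem measurableSet_Ioo).mono h

theorem intervalIntegrable_logTanQuadratic :
    IntervalIntegrable logTanQuadratic volume 0 (π / 2) :=
  intervalIntegrable_of_abs_le pi_div_two_pos.le
    (intervalIntegrable_abs_log_add_sq _ pi_div_two_pos.le) continuousOn_logTanQuadratic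
    fun _ hθ => abs_logTanQuadratic_le hθ

theorem ae_mem_uIoc_imp_of_Ioo {p : ℝ → Prop} {a b : ℝ} (hab : a ≤ b)
    (h : ∀ x ∈ Ioo a b, p x) : ∀ᵐ x ∂volume, x ∈ uIoc a b → p x := by
  have hb : ∀ᵐ x : ℝ ∂volume, x ≠ b := by simp [ae_iff]
  filter_upwards [hb] with x hx hx'
  rw [uIoc_of_le hab] at hx'
  exact h x ⟨hx'.1, lt_of_le_of_ne hx'.2 hx⟩

/-- Both sides of `integral_arc_re` are taken to r → 1 from below: the arc by dominated convergence,
the primitives by continuity on [0, 1]. -/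
theorem integral_logTanQuadratic :
    ∫ θ in (0 : ℝ)..(π / 2), logTanQuadratic θ =
      -4 * arctanLogPrimitive 1 + 8 * log 2 * catalanConstant := by
  have hlt : ∀ᶠ r : ℝ in 𝓝[<] 1, r ∈ Ioo (0 : ℝ) 1 := Ioo_mem_nhdsLT one_pos
  have hlim : Tendsto (fun r : ℝ => ∫ ω in (0 : ℝ)..(π / 2),
      (logRatio (r * Complex.exp (ω * Complex.I)) *
        contourFactor (r * Complex.exp (ω * Complex.I))).re) (𝓝[<] 1)
      (𝓝 (∫ ω in (0 : ℝ)..(π / 2), (logTanQuadratic ω + (π * ω - π ^ 2 / 4)))) := by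
    refine intervalIntegral.tendsto_integral_filter_of_dominated_convergence
      (fun ω => (|log ω| + (log (π / 2) + 10 * (log 2 + π))) ^ 2) ?_ ?_
      (intervalIntegrable_abs_log_add_sq _ pi_div_two_pos.le) ?_
    · filter_upwards [hlt] with r hr
      exact (continuous_arc_re hr.1 hr.2).aestronglyMeasurable
    · filter_upwards [hlt] with r hr
      exact ae_mem_uIoc_imp_of_Ioo pi_div_two_pos.le fun ω hω =>
        (Complex.abs_re_le_norm _).trans (norm_logRatio_mul_contourFactor_le hr.1 hr.2 hω)
    · refine ae_mem_uIoc_imp_of_Ioo pi_div_two_pos.le fun ω hω => ?_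
      rw [← re_logRatio_mul_contourFactor_exp hω]
      have hc : cos ω < 1 := by
        rw [← cos_zero]
        exact cos_lt_cos_of_nonneg_of_le_pi le_rfl (by linarith [hω.2, pi_pos]) hω.1
      have hc0 : 0 < cos ω := cos_pos_of_mem_Ioo ⟨by linarith [hω.1, pi_pos], hω.2⟩
      have ha : 1 - Complex.exp (ω * Complex.I) ∈ Complex.slitPlane := Or.inl (by
        rw [Complex.sub_re, Complex.exp_ofReal_mul_I_re, Complex.one_re]; linarith)
      have hb : 1 + Complex.exp (ω * Complex.I) ∈ Complex.slitPlane := Or.inl (by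
        rw [Complex.add_re, Complex.exp_ofReal_mul_I_re, Complex.one_re]; linarith)
      have hm : Tendsto (fun r : ℝ => (r : ℂ) * Complex.exp (ω * Complex.I)) (𝓝[<] 1)
          (𝓝 (Complex.exp (ω * Complex.I))) := by
        have : Continuous fun r : ℝ => (r : ℂ) * Complex.exp (ω * Complex.I) := by fun_prop
        have h1 := this.tendsto 1
        rw [Complex.ofReal_one, one_mul] at h1
        exact h1.mono_left nhdsWithin_le_nhds
      exact (Complex.continuous_re.tendsto _).comp
        (((differentiableAt_logRatio ha hb).continuousAt.tendsto.comp hm).mul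
          ((differentiableAt_contourFactor ha hb).continuousAt.tendsto.comp hm))
  have hlim2 : Tendsto (fun r => -4 * arctanLogPrimitive r + 8 * log 2 * arctanIntegral r)
      (𝓝[<] 1) (𝓝 (-4 * arctanLogPrimitive 1 + 8 * log 2 * arctanIntegral 1)) := by
    have hc : ContinuousOn (fun r => -4 * arctanLogPrimitive r + 8 * log 2 * arctanIntegral r)
        (Icc 0 1) := (continuousOn_const.mul continuousOn_arctanLogPrimitive).add
          (continuousOn_const.mul continuousOn_arctanIntegral)
    refine (hc 1 (by simp)).mono_left ?_
    rw [nhdsWithin_le_iff]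
    exact mem_of_superset (Ioo_mem_nhdsLT one_pos) Ioo_subset_Icc_self
  have h := tendsto_nhds_unique (hlim.congr' (by
    filter_upwards [hlt] with r hr
    exact integral_arc_re hr.1 hr.2)) hlim2
  rw [intervalIntegral.integral_add intervalIntegrable_logTanQuadratic
    (Continuous.intervalIntegrable (by fun_prop) _ _), arctanIntegral_one] at h
  have h2 : ∫ ω in (0 : ℝ)..(π / 2), (π * ω - π ^ 2 / 4) = 0 := by
    rw [intervalIntegral.integral_sub (Continuous.intervalIntegrable (by fun_prop) _ _)
      (by simp), intervalIntegral.integral_const_mul, integral_id, intervalIntegral.integral_const,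
      smul_eq_mul]
    ring
  rw [h2, add_zero] at h
  exact h

/-! ### Half-angle substitution and the two limiting integrals -/

theorem hasSum_intervalIntegral_of_nonneg {f : ℕ → ℝ → ℝ} {g : ℝ → ℝ} {a b : ℝ} (hab : a ≤ b)
    (hf : ∀ n, IntervalIntegrable (f n) volume a b) (h0 : ∀ n, ∀ x ∈ Ioo a b, 0 ≤ f n x)
    (hs : Summable fun n => ∫ x in a..b, f n x)
    (hg : ∀ x ∈ Ioo a b, HasSum (fun n => f n x) (g x)) :
    HasSum (fun n => ∫ x in a..b, f n x) (∫ x in a..b, g x) := by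
  have e : ∀ h : ℝ → ℝ, ∫ x in a..b, h x = ∫ x in Ioo a b, h x := fun h => by
    rw [intervalIntegral.integral_of_le hab, integral_Ioc_eq_integral_Ioo]
  simp only [e] at hs ⊢
  have h1 : ∀ n, ∫ x in Ioo a b, ‖f n x‖ = ∫ x in Ioo a b, f n x := fun n =>
    setIntegral_congr_fun measurableSet_Ioo fun x hx => Real.norm_of_nonneg (h0 n x hx)
  have h := hasSum_integral_of_summable_integral_norm (μ := volume.restrict (Ioo a b)) (F := f)
    (fun n => (intervalIntegrable_iff_integrableOn_Ioo_of_le hab).mp (hf n)) (by simpa only [h1])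
  have h2 : ∫ x in Ioo a b, ∑' n, f n x = ∫ x in Ioo a b, g x :=
    setIntegral_congr_fun measurableSet_Ioo fun x hx => (hg x hx).tsum_eq
  rwa [h2] at h

theorem cos_half_pos {θ : ℝ} (hθ : θ ∈ Icc 0 (π / 2)) : 0 < cos (θ / 2) :=
  cos_pos_of_mem_Ioo ⟨by linarith [hθ.1, pi_pos], by linarith [hθ.2, pi_pos]⟩

theorem continuousOn_tan_half : ContinuousOn (fun θ : ℝ => tan (θ / 2)) (Icc 0 (π / 2)) :=
  fun _ hθ => (ContinuousAt.comp (f := fun θ : ℝ => θ / 2)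
    (continuousAt_tan.mpr (cos_half_pos hθ).ne') (by fun_prop)).continuousWithinAt

theorem tan_half_mem_Icc {θ : ℝ} (hθ : θ ∈ Icc 0 (π / 2)) : tan (θ / 2) ∈ Icc (0 : ℝ) 1 := by
  refine ⟨tan_nonneg_of_nonneg_of_le_pi_div_two (by linarith [hθ.1])
    (by linarith [hθ.1, hθ.2]), ?_⟩
  rw [← tan_pi_div_four]
  exact strictMonoOn_tan.monotoneOn ⟨by linarith [hθ.1, pi_pos], by linarith [hθ.2, pi_pos]⟩
    ⟨by linarith [pi_pos], by linarith [pi_pos]⟩ (by linarith [hθ.2])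

theorem hasDerivAt_tan_half {θ : ℝ} (hθ : θ ∈ Ioo 0 (π / 2)) :
    HasDerivAt (fun θ : ℝ => tan (θ / 2)) (tan (θ / 2) / sin θ) θ := by
  have hc := cos_half_pos (Ioo_subset_Icc_self hθ)
  have h := HasDerivAt.comp θ (Real.hasDerivAt_tan hc.ne') ((hasDerivAt_id θ).div_const 2)
  refine h.congr_deriv ?_
  have hs : 0 < sin (θ / 2) :=
    sin_pos_of_pos_of_lt_pi (by linarith [hθ.1]) (by linarith [hθ.2, pi_pos])
  have e : sin θ = 2 * sin (θ / 2) * cos (θ / 2) := by rw [← sin_two_mul]; ring_nf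
  simp only [id]
  rw [e, tan_eq_sin_div_cos]
  field_simp

theorem hasDerivAt_log_tan_half {θ : ℝ} (hθ : θ ∈ Ioo 0 (π / 2)) :
    HasDerivAt (fun θ : ℝ => log (tan (θ / 2))) (1 / sin θ) θ := by
  have ht := (tan_half_mem_Ioo hθ).1.ne'
  refine ((hasDerivAt_tan_half hθ).log ht).congr_deriv ?_
  field_simp

theorem sin_pos_of_mem_Ioo_pi_div_two {θ : ℝ} (hθ : θ ∈ Ioo 0 (π / 2)) : 0 < sin θ :=
  sin_pos_of_pos_of_lt_pi hθ.1 (by linarith [hθ.2, pi_pos])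

theorem cos_pos_of_mem_Ioo_pi_div_two {θ : ℝ} (hθ : θ ∈ Ioo 0 (π / 2)) : 0 < cos θ :=
  cos_pos_of_mem_Ioo ⟨by linarith [hθ.1, pi_pos], hθ.2⟩

theorem intervalIntegrable_mul_neg_log_tan_half {h : ℝ → ℝ} (hc : ContinuousOn h (Ioo 0 (π / 2)))
    (hb : ∀ θ ∈ Ioo 0 (π / 2), |h θ| ≤ 1) :
    IntervalIntegrable (fun θ => h θ * -log (tan (θ / 2))) volume 0 (π / 2) := by
  have hg : IntervalIntegrable (fun θ => |log θ| + log 2) volume 0 (π / 2) :=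
    intervalIntegral.intervalIntegrable_log'.abs.add intervalIntegrable_const
  refine intervalIntegrable_of_abs_le pi_div_two_pos.le hg ?_ fun θ hθ => ?_
  · exact hc.mul fun θ hθ => (hasDerivAt_log_tan_half hθ).continuousAt.continuousWithinAt.neg
  · have h1 := log_tan_half_nonpos hθ
    rw [abs_mul, abs_neg, abs_of_nonpos h1]
    calc _ ≤ 1 * -log (tan (θ / 2)) :=
          mul_le_mul_of_nonneg_right (hb θ hθ) (by linarith)
      _ ≤ _ := by rw [one_mul]; exact neg_log_tan_half_le hθ

theorem intervalIntegrable_sin_pow_mul_cos_mul_neg_log_tan_half (n : ℕ) :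
    IntervalIntegrable (fun θ => sin θ ^ (2 * n) * cos θ * -log (tan (θ / 2))) volume
      0 (π / 2) := by
  refine intervalIntegrable_mul_neg_log_tan_half (h := fun θ => sin θ ^ (2 * n) * cos θ)
    (by fun_prop) fun θ _ => ?_
  rw [abs_mul, abs_pow]
  exact mul_le_one₀ (pow_le_one₀ (abs_nonneg _) (abs_sin_le_one θ)) (abs_nonneg _)
    (abs_cos_le_one θ)

/-- Integration by parts: sin^(2n) θ cos θ integrates to sin^(2n+1) θ/(2n+1) and log tan(θ/2) has
derivative 1/sin θ, which leaves the even sine moment. -/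
theorem integral_sin_pow_mul_cos_mul_neg_log_tan_half (n : ℕ) :
    ∫ θ in (0 : ℝ)..(π / 2), sin θ ^ (2 * n) * cos θ * -log (tan (θ / 2)) =
      π / 2 * centralRatio n / (2 * n + 1) := by
  have hn : (2 * (n : ℝ) + 1) ≠ 0 := by positivity
  have hi := intervalIntegrable_sin_pow_mul_cos_mul_neg_log_tan_half n
  have hi2 : IntervalIntegrable (fun θ => sin θ ^ (2 * n) / (2 * n + 1)) volume 0 (π / 2) :=
    Continuous.intervalIntegrable (by fun_prop) _ _
  -- This is -sin^(2n+1) θ · log tan(θ/2)/(2n+1), with one factor sin θ written as 2 cos²(θ/2)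
  -- tan(θ/2), so that continuity at 0 reduces to that of y log y.
  have hcont : ContinuousOn (fun θ : ℝ => -(2 * cos (θ / 2) ^ 2 *
      (tan (θ / 2) * log (tan (θ / 2))) * sin θ ^ (2 * n) / (2 * n + 1))) (Icc 0 (π / 2)) := by
    have h1 : ContinuousOn (fun θ : ℝ => tan (θ / 2) * log (tan (θ / 2))) (Icc 0 (π / 2)) :=
      Real.continuous_mul_log.comp_continuousOn continuousOn_tan_half
    fun_prop
  have h := intervalIntegral.integral_eq_sub_of_hasDerivAt_of_le
    (f' := fun θ => sin θ ^ (2 * n) * cos θ * -log (tan (θ / 2)) - sin θ ^ (2 * n) / (2 * n + 1))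
    pi_div_two_pos.le hcont (fun θ hθ => ?_) (hi.sub hi2)
  · rw [intervalIntegral.integral_sub hi hi2, intervalIntegral.integral_div,
      integral_sin_pow_even_zero_pi_div_two] at h
    have e : π / 2 / 2 = π / 4 := by ring
    simp only [e, tan_pi_div_four, Real.log_one, mul_zero, zero_mul, zero_div, neg_zero,
      tan_zero] at h
    linarith
  · have hs := (sin_pos_of_mem_Ioo_pi_div_two hθ).ne'
    have hd := ((((hasDerivAt_sin θ).fun_pow (2 * n + 1)).fun_mul
      (hasDerivAt_log_tan_half hθ)).div_const (2 * (n : ℝ) + 1)).fun_neg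
    refine (hd.congr_of_eventuallyEq ?_).congr_deriv ?_
    · filter_upwards [isOpen_Ioo.mem_nhds hθ] with x hx
      have hc := (cos_half_pos (Ioo_subset_Icc_self hx)).ne'
      have e : sin x = 2 * cos (x / 2) ^ 2 * tan (x / 2) := by
        have : sin x = 2 * sin (x / 2) * cos (x / 2) := by rw [← sin_two_mul]; ring_nf
        rw [this, tan_eq_sin_div_cos]
        field_simp
      rw [pow_succ (sin x) (2 * n)]
      nth_rewrite 3 [e]
      ring
    · push_cast
      rw [pow_succ]
      field_simp
      ring

theorem continuousOn_mul_cos_div_sin :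
    ContinuousOn (fun θ : ℝ => θ / sin θ * cos θ) (Ioo 0 (π / 2)) :=
  (continuousOn_id.div continuous_sin.continuousOn
    fun _ hθ => (sin_pos_of_mem_Ioo_pi_div_two hθ).ne').mul continuous_cos.continuousOn

/-- The factor θ cot θ is at most 1 because θ < tan θ. -/
theorem intervalIntegrable_mul_cot_mul_neg_log_tan_half :
    IntervalIntegrable (fun θ => θ / sin θ * cos θ * -log (tan (θ / 2))) volume 0 (π / 2) := by
  refine intervalIntegrable_mul_neg_log_tan_half continuousOn_mul_cos_div_sin fun θ hθ => ?_
  have hs := sin_pos_of_mem_Ioo_pi_div_two hθ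
  have hc := cos_pos_of_mem_Ioo_pi_div_two hθ
  have ht := lt_tan hθ.1 hθ.2
  rw [tan_eq_sin_div_cos, lt_div_iff₀ hc] at ht
  rw [abs_of_nonneg (by have := hθ.1; positivity), div_mul_eq_mul_div, div_le_one hs]
  exact ht.le

theorem tendsto_tan_half_nhdsGT_zero :
    Tendsto (fun θ : ℝ => tan (θ / 2)) (𝓝[>] 0) (𝓝 0) := by
  have h : ContinuousAt (fun θ : ℝ => tan (θ / 2)) 0 :=
    ContinuousAt.comp (f := fun θ : ℝ => θ / 2) (continuousAt_tan.mpr (by simp)) (by fun_prop)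
  have h' := h.tendsto
  simp only [zero_div, tan_zero] at h'
  exact h'.mono_left nhdsWithin_le_nhds

theorem tendsto_mul_log_tan_half :
    Tendsto (fun θ : ℝ => θ * log (tan (θ / 2))) (𝓝[>] 0) (𝓝 0) := by
  have h1 : Tendsto (fun θ : ℝ => 2 * (tan (θ / 2) * log (tan (θ / 2)))) (𝓝[>] 0) (𝓝 0) := by
    have := ((Real.continuous_mul_log.tendsto 0).comp tendsto_tan_half_nhdsGT_zero).const_mul 2
    simpa using this
  have hI : Ioo 0 (π / 2) ∈ 𝓝[>] (0 : ℝ) := Ioo_mem_nhdsGT pi_div_two_pos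
  refine tendsto_of_tendsto_of_tendsto_of_le_of_le' h1 tendsto_const_nhds ?_ ?_
  · filter_upwards [hI] with θ hθ
    have h2 := log_tan_half_nonpos hθ
    have h3 : θ / 2 < tan (θ / 2) := lt_tan (by linarith [hθ.1]) (by linarith [hθ.1, hθ.2])
    nlinarith
  · filter_upwards [hI] with θ hθ
    exact mul_nonpos_of_nonneg_of_nonpos hθ.1.le (log_tan_half_nonpos hθ)

/-- Since θ < 2 tan(θ/2), it is enough that y log² y → 0, and y log² y = 4(√y log √y)². -/
theorem tendsto_mul_log_tan_half_sq :
    Tendsto (fun θ : ℝ => θ * log (tan (θ / 2)) ^ 2) (𝓝[>] 0) (𝓝 0) := by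
  have h1 : Tendsto (fun θ : ℝ => 8 * (√(tan (θ / 2)) * log √(tan (θ / 2))) ^ 2) (𝓝[>] 0)
      (𝓝 0) := by
    have hs : Tendsto (fun θ : ℝ => √(tan (θ / 2))) (𝓝[>] 0) (𝓝 0) := by
      have := (Real.continuous_sqrt.tendsto 0).comp tendsto_tan_half_nhdsGT_zero
      rwa [Real.sqrt_zero] at this
    have := (((Real.continuous_mul_log.tendsto 0).comp hs).pow 2).const_mul 8
    simpa using this
  have hI : Ioo 0 (π / 2) ∈ 𝓝[>] (0 : ℝ) := Ioo_mem_nhdsGT pi_div_two_pos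
  refine tendsto_of_tendsto_of_tendsto_of_le_of_le' tendsto_const_nhds h1 ?_ ?_
  · filter_upwards [hI] with θ hθ
    exact mul_nonneg hθ.1.le (sq_nonneg _)
  · filter_upwards [hI] with θ hθ
    have ht := (tan_half_mem_Ioo hθ).1
    have h3 : θ / 2 < tan (θ / 2) := lt_tan (by linarith [hθ.1]) (by linarith [hθ.1, hθ.2])
    rw [Real.log_sqrt ht.le, mul_pow, Real.sq_sqrt ht.le]
    nlinarith [sq_nonneg (log (tan (θ / 2)))]

theorem tendsto_comp_tan_half {w : ℝ → ℝ} (hw : ContinuousOn w (Icc 0 1)) :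
    Tendsto (fun θ => w (tan (θ / 2))) (𝓝[>] 0) (𝓝 (w 0)) ∧
      Tendsto (fun θ => w (tan (θ / 2))) (𝓝[<] (π / 2)) (𝓝 (w 1)) := by
  have hc : ContinuousOn (fun θ : ℝ => w (tan (θ / 2))) (Icc 0 (π / 2)) :=
    hw.comp continuousOn_tan_half fun θ hθ => tan_half_mem_Icc hθ
  have e : π / 2 / 2 = π / 4 := by ring
  constructor
  · have h := (hc 0 ⟨le_rfl, pi_div_two_pos.le⟩).tendsto
    simp only [zero_div, tan_zero] at h
    refine h.mono_left ?_
    rw [nhdsWithin_le_iff]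
    exact mem_of_superset (Ioo_mem_nhdsGT pi_div_two_pos) Ioo_subset_Icc_self
  · have h := (hc (π / 2) ⟨pi_div_two_pos.le, le_rfl⟩).tendsto
    simp only [e, tan_pi_div_four] at h
    refine h.mono_left ?_
    rw [nhdsWithin_le_iff]
    exact mem_of_superset (Ioo_mem_nhdsLT pi_div_two_pos) Ioo_subset_Icc_self

theorem log_one_add_tan_half_sq {θ : ℝ} (hθ : θ ∈ Ioo 0 (π / 2)) :
    log (1 + tan (θ / 2) ^ 2) = -2 * log (cos (θ / 2)) := by
  have hc := cos_half_pos (Ioo_subset_Icc_self hθ)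
  have e : 1 + tan (θ / 2) ^ 2 = (cos (θ / 2) ^ 2)⁻¹ := by
    rw [tan_eq_sin_div_cos]
    field_simp
    linarith [sin_sq_add_cos_sq (θ / 2)]
  rw [e, Real.log_inv, Real.log_pow]
  push_cast
  ring

theorem arctan_tan_half {θ : ℝ} (hθ : θ ∈ Ioo 0 (π / 2)) : arctan (tan (θ / 2)) = θ / 2 :=
  arctan_tan (by linarith [hθ.1, pi_pos]) (by linarith [hθ.1, hθ.2])

theorem hasDerivAt_arctanLogPrimitive_tan_half {θ : ℝ} (hθ : θ ∈ Ioo 0 (π / 2)) :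
    HasDerivAt (fun θ => arctanLogPrimitive (tan (θ / 2))) (-(θ * log (cos (θ / 2)) / sin θ)) θ := by
  have ht := tan_half_mem_Ioo hθ
  have ht0 := ht.1.ne'
  refine ((hasDerivAt_arctanLogPrimitive ht).comp θ (hasDerivAt_tan_half hθ)).congr_deriv ?_
  rw [log_one_add_tan_half_sq hθ, arctan_tan_half hθ]
  field_simp

/-- The difference between the integrand and half of `logTanQuadratic` has an explicit primitive. It
tends to 0 at 0; at π/2, where log tan(θ/2) vanishes, only the `arctanLogPrimitive` term survives.
-/
theorem integral_mul_cot_mul_neg_log_tan_half :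
    ∫ θ in (0 : ℝ)..(π / 2), θ / sin θ * cos θ * -log (tan (θ / 2)) =
      4 * (log 2 * catalanConstant - arctanLogPrimitive 1) := by
  have hi := intervalIntegrable_mul_cot_mul_neg_log_tan_half
  have hi2 := intervalIntegrable_logTanQuadratic.const_mul (1 / 2)
  have h := intervalIntegral.integral_eq_sub_of_hasDerivAt_of_tendsto (fa := 0)
    (fb := -2 * arctanLogPrimitive 1)
    (f := fun θ => -(1 / 2) * (θ * log (tan (θ / 2)) ^ 2)
      - 2 * (log (cos (θ / 2)) * (θ * log (tan (θ / 2)))) - 2 * arctanLogPrimitive (tan (θ / 2)))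
    (f' := fun θ => θ / sin θ * cos θ * -log (tan (θ / 2)) - 1 / 2 * logTanQuadratic θ)
    pi_div_two_pos ?_ (hi.sub hi2) ?_ ?_
  · rw [intervalIntegral.integral_sub hi hi2, intervalIntegral.integral_const_mul,
      integral_logTanQuadratic] at h
    linarith
  · intro θ hθ
    have hs := (sin_pos_of_mem_Ioo_pi_div_two hθ).ne'
    have hc := (cos_half_pos (Ioo_subset_Icc_self hθ)).ne'
    have hl := hasDerivAt_log_tan_half hθ
    have hlc : HasDerivAt (fun θ : ℝ => log (cos (θ / 2))) (-(tan (θ / 2) / 2)) θ := by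
      refine ((((hasDerivAt_id θ).div_const 2).cos).log hc).congr_deriv ?_
      simp only [id]
      rw [tan_eq_sin_div_cos]
      field_simp
    refine (((((hasDerivAt_id θ).fun_mul (hl.fun_pow 2)).const_mul (-(1 / 2))).fun_sub
      ((hlc.fun_mul ((hasDerivAt_id θ).fun_mul hl)).const_mul 2)).fun_sub
      ((hasDerivAt_arctanLogPrimitive_tan_half hθ).const_mul 2)).congr_deriv ?_
    -- Differentiation leaves -θL/sin θ + θL tan(θ/2), with L = log tan(θ/2); this identity merges
    -- the two into -θL cot θ.
    have e : cos θ = 1 - tan (θ / 2) * sin θ := by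
      have e1 : sin θ = 2 * sin (θ / 2) * cos (θ / 2) := by rw [← sin_two_mul]; ring_nf
      have e2 : cos θ = 1 - 2 * sin (θ / 2) ^ 2 := by
        rw [← Real.cos_two_mul_eq_one_sub]; ring_nf
      rw [e1, e2, tan_eq_sin_div_cos]
      field_simp
    rw [logTanQuadratic, e]
    simp only [id]
    push_cast
    field_simp
    ring
  · have h1 : Tendsto (fun θ : ℝ => log (cos (θ / 2))) (𝓝[>] 0) (𝓝 0) := by
      have : ContinuousAt (fun θ : ℝ => log (cos (θ / 2))) 0 :=
        ContinuousAt.log (by fun_prop) (by simp)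
      have h' := this.tendsto
      simp only [zero_div, cos_zero, Real.log_one] at h'
      exact h'.mono_left nhdsWithin_le_nhds
    have h2 := (tendsto_comp_tan_half continuousOn_arctanLogPrimitive).1
    rw [arctanLogPrimitive_zero] at h2
    have h3 := ((tendsto_mul_log_tan_half_sq.const_mul (-(1 / 2))).sub
      ((h1.mul tendsto_mul_log_tan_half).const_mul 2)).sub (h2.const_mul 2)
    simp only [mul_zero, sub_zero] at h3
    exact h3
  · have h2 := (tendsto_comp_tan_half continuousOn_arctanLogPrimitive).2
    have e : π / 2 / 2 = π / 4 := by ring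
    have hl : ContinuousAt (fun θ : ℝ => log (tan (θ / 2))) (π / 2) := by
      refine ContinuousAt.log (ContinuousAt.comp (f := fun θ : ℝ => θ / 2)
        (continuousAt_tan.mpr (cos_half_pos ⟨pi_div_two_pos.le, le_rfl⟩).ne') (by fun_prop)) ?_
      rw [e, tan_pi_div_four]
      exact one_ne_zero
    have hlc : ContinuousAt (fun θ : ℝ => log (cos (θ / 2))) (π / 2) :=
      ContinuousAt.log (by fun_prop) (cos_half_pos ⟨pi_div_two_pos.le, le_rfl⟩).ne'
    have hA : ContinuousAt (fun θ : ℝ => -(1 / 2) * (θ * log (tan (θ / 2)) ^ 2)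
        - 2 * (log (cos (θ / 2)) * (θ * log (tan (θ / 2))))) (π / 2) := by fun_prop
    have hA' := hA.tendsto
    rw [e, tan_pi_div_four, Real.log_one] at hA'
    have h3 := (hA'.mono_left (nhdsWithin_le_nhds (s := Iio (π / 2)))).sub (h2.const_mul 2)
    convert h3 using 2
    ring

/-- Under t = tan(θ/2) one has dθ/sin θ = dt/t and θ = 2 arctan t. -/
theorem integral_div_sin :
    IntervalIntegrable (fun θ => θ / sin θ) volume 0 (π / 2) ∧
      ∫ θ in (0 : ℝ)..(π / 2), θ / sin θ = 2 * catalanConstant := by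
  have hc : ContinuousOn (fun θ : ℝ => 2 * arctanIntegral (tan (θ / 2))) (Icc 0 (π / 2)) :=
    continuousOn_const.mul
      (continuousOn_arctanIntegral.comp continuousOn_tan_half fun θ hθ => tan_half_mem_Icc hθ)
  have hd : ∀ θ ∈ Ioo 0 (π / 2), HasDerivAt (fun θ : ℝ => 2 * arctanIntegral (tan (θ / 2)))
      (θ / sin θ) θ := fun θ hθ => by
    have ht := tan_half_mem_Ioo hθ
    have ht0 := ht.1.ne'
    refine (((hasDerivAt_arctanIntegral ht).comp θ (hasDerivAt_tan_half hθ)).const_mul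
      2).congr_deriv ?_
    rw [arctan_tan_half hθ]
    field_simp
  have hi : IntervalIntegrable (fun θ => θ / sin θ) volume 0 (π / 2) :=
    intervalIntegral.intervalIntegrable_deriv_of_nonneg
      (by rwa [uIcc_of_le pi_div_two_pos.le])
      (by rwa [min_eq_left pi_div_two_pos.le, max_eq_right pi_div_two_pos.le])
      (by
        rw [min_eq_left pi_div_two_pos.le, max_eq_right pi_div_two_pos.le]
        exact fun θ hθ => div_nonneg hθ.1.le (sin_pos_of_mem_Ioo_pi_div_two hθ).le)
  refine ⟨hi, ?_⟩
  rw [intervalIntegral.integral_eq_sub_of_hasDerivAt_of_le pi_div_two_pos.le hc hd hi]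
  have e : π / 2 / 2 = π / 4 := by ring
  rw [e, tan_pi_div_four, zero_div, tan_zero, arctanIntegral_one, arctanIntegral_zero]
  ring

/-! ### Summing the series with denominators 2n+1 and (2n+1)² -/

theorem centralRatio_sq_mul_le (n : ℕ) : centralRatio n ^ 2 * (2 * n + 1) ≤ 1 := by
  induction n with
  | zero => simp [centralRatio_zero]
  | succ n ih =>
    have e : centralRatio (n + 1) ^ 2 * (2 * ((n + 1 : ℕ) : ℝ) + 1) =
        centralRatio n ^ 2 * (2 * n + 1) * ((2 * n + 1) * (2 * n + 3) / (2 * n + 2) ^ 2) := by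
      rw [centralRatio_succ]
      push_cast
      field_simp
      ring
    rw [e]
    refine mul_le_one₀ ih (by positivity) ?_
    rw [div_le_one (by positivity)]
    nlinarith

theorem summable_centralRatio_sq_div :
    Summable fun n : ℕ => centralRatio n ^ 2 / (2 * n + 1) := by
  refine (summable_one_div_succ_pow le_rfl).of_nonneg_of_le (fun n => by positivity) fun n => ?_
  have h := centralRatio_sq_mul_le n
  have hn : (0 : ℝ) ≤ n := n.cast_nonneg
  rw [div_le_div_iff₀ (by positivity) (by positivity)]
  nlinarith [sq_nonneg (centralRatio n), mul_nonneg (sq_nonneg (centralRatio n)) hn,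
    mul_nonneg (mul_nonneg (sq_nonneg (centralRatio n)) hn) hn]

/-- The arcsine series is integrated termwise over (0, π/2) against the even sine moments. -/
theorem hasSum_centralRatio_sq_div :
    HasSum (fun n : ℕ => centralRatio n ^ 2 / (2 * n + 1)) (4 / π * catalanConstant) := by
  have hint : ∀ n : ℕ, ∫ θ in (0 : ℝ)..(π / 2), centralRatio n / (2 * n + 1) * sin θ ^ (2 * n) =
      π / 2 * (centralRatio n ^ 2 / (2 * n + 1)) := fun n => by
    rw [intervalIntegral.integral_const_mul, integral_sin_pow_even_zero_pi_div_two]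
    ring
  have h := hasSum_intervalIntegral_of_nonneg pi_div_two_pos.le
    (f := fun (n : ℕ) θ => centralRatio n / (2 * n + 1) * sin θ ^ (2 * n)) (g := fun θ => θ / sin θ)
    (fun n => Continuous.intervalIntegrable (by fun_prop) _ _)
    (fun n θ _ => by
      have := (centralRatio_pos n).le
      rw [pow_mul]
      positivity)
    (by simpa only [hint] using summable_centralRatio_sq_div.mul_left (π / 2))
    fun θ hθ => hasSum_centralRatio_div_mul_sin_pow hθ
  simp only [hint, integral_div_sin] at h
  have h2 := h.mul_left (2 / π)
  have e : 2 / π * (2 * catalanConstant) = 4 / π * catalanConstant := by ring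
  rw [e] at h2
  refine h2.congr_fun fun n => ?_
  field_simp

theorem summable_centralRatio_sq_div_sq :
    Summable fun n : ℕ => 1 / (2 * (n : ℝ) + 1) ^ 2 * centralRatio n ^ 2 := by
  refine summable_centralRatio_sq_div.of_nonneg_of_le (fun n => by positivity) fun n => ?_
  have hn : (0 : ℝ) ≤ n := n.cast_nonneg
  rw [one_div_mul_eq_div]
  gcongr
  nlinarith

theorem hasSum_centralRatio_sq_div_sq :
    HasSum (fun n : ℕ => 1 / (2 * (n : ℝ) + 1) ^ 2 * centralRatio n ^ 2)
      (3 * π ^ 2 / 8 + log 2 ^ 2 / 2 - 16 / π * (polyLog 3 ((1 + Complex.I) / 2)).im) := by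
  have hint : ∀ n : ℕ, ∫ θ in (0 : ℝ)..(π / 2), centralRatio n / (2 * n + 1) *
      (sin θ ^ (2 * n) * cos θ * -log (tan (θ / 2))) =
      π / 2 * (1 / (2 * (n : ℝ) + 1) ^ 2 * centralRatio n ^ 2) := fun n => by
    rw [intervalIntegral.integral_const_mul, integral_sin_pow_mul_cos_mul_neg_log_tan_half]
    field_simp
  have h := hasSum_intervalIntegral_of_nonneg pi_div_two_pos.le
    (f := fun (n : ℕ) θ => centralRatio n / (2 * n + 1) *
      (sin θ ^ (2 * n) * cos θ * -log (tan (θ / 2))))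
    (g := fun θ => θ / sin θ * cos θ * -log (tan (θ / 2)))
    (fun n => (intervalIntegrable_sin_pow_mul_cos_mul_neg_log_tan_half n).const_mul _)
    (fun n θ hθ => by
      have h1 := (centralRatio_pos n).le
      have h2 := (sin_pos_of_mem_Ioo_pi_div_two hθ).le
      have h3 := (cos_pos_of_mem_Ioo_pi_div_two hθ).le
      have h4 : 0 ≤ -log (tan (θ / 2)) := neg_nonneg.mpr (log_tan_half_nonpos hθ)
      positivity)
    (by simpa only [hint] using summable_centralRatio_sq_div_sq.mul_left (π / 2))
    fun θ hθ => by
      refine (((hasSum_centralRatio_div_mul_sin_pow hθ).mul_right (cos θ)).mul_right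
        (-log (tan (θ / 2)))).congr_fun fun n => ?_
      ring
  simp only [hint, integral_mul_cot_mul_neg_log_tan_half] at h
  have h2 := h.mul_left (2 / π)
  -- The K log 2 inside `arctanLogPrimitive 1` cancels here.
  have e : 2 / π * (4 * (log 2 * catalanConstant - arctanLogPrimitive 1)) =
      3 * π ^ 2 / 8 + log 2 ^ 2 / 2 - 16 / π * (polyLog 3 ((1 + Complex.I) / 2)).im := by
    rw [arctanLogPrimitive_one]
    field_simp
    ring
  rw [e] at h2
  refine h2.congr_fun fun n => ?_
  field_simp

/-! ### Telescoping sums and the second series -/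

theorem hasSum_of_tendsto_of_sub_eq {f g : ℕ → ℝ} {l : ℝ} (hg : ∀ n, g (n + 1) - g n = f n)
    (hf : ∀ n, 0 ≤ f n) (hl : Tendsto g atTop (𝓝 l)) : HasSum f (l - g 0) := by
  rw [hasSum_iff_tendsto_nat_of_nonneg hf]
  have : ∀ n, ∑ i ∈ Finset.range n, f i = g n - g 0 := fun n => by
    rw [← Finset.sum_range_sub g n]
    exact Finset.sum_congr rfl fun i _ => (hg i).symm
  simp only [this]
  exact hl.sub_const _

/-- The sequence n c_n² has increments c_n²/(4(n+1)) and tends to 1/π by Wallis' product. -/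
theorem hasSum_centralRatio_sq_div_succ :
    HasSum (fun n : ℕ => centralRatio n ^ 2 / (n + 1)) (4 / π) := by
  have h := hasSum_of_tendsto_of_sub_eq (g := fun n : ℕ => (n : ℝ) * centralRatio n ^ 2)
    (f := fun n : ℕ => centralRatio n ^ 2 / (4 * (n + 1))) (fun n => by
      rw [centralRatio_succ]
      push_cast
      field_simp
      ring) (fun n => by positivity) tendsto_mul_centralRatio_sq
  have h2 := h.mul_left 4
  simp only [Nat.cast_zero, zero_mul, sub_zero, mul_one_div] at h2
  refine h2.congr_fun fun n => ?_
  field_simp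

theorem tendsto_centralRatio_sq : Tendsto (fun n => centralRatio n ^ 2) atTop (𝓝 0) := by
  refine squeeze_zero (fun n => by positivity) (fun n => ?_)
    (tendsto_one_div_add_atTop_nhds_zero_nat (𝕜 := ℝ))
  rw [le_div_iff₀ (by positivity)]
  nlinarith [centralRatio_sq_mul_le n, mul_nonneg (sq_nonneg (centralRatio n)) n.cast_nonneg]

/-- The decrements of c_n² are c_n²/(n+1) - c_n²/(4(n+1)²) and sum to c_0² = 1; subtracting from the
previous sum isolates the square. -/
theorem hasSum_centralRatio_sq_div_succ_sq :
    HasSum (fun n : ℕ => centralRatio n ^ 2 / (4 * ((n : ℝ) + 1) ^ 2)) (4 / π - 1) := by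
  have h := hasSum_of_tendsto_of_sub_eq (g := fun n : ℕ => -centralRatio n ^ 2)
    (f := fun n : ℕ => centralRatio n ^ 2 / (n + 1) -
      centralRatio n ^ 2 / (4 * ((n : ℝ) + 1) ^ 2)) (fun n => by
      rw [centralRatio_succ]
      field_simp
      ring) (fun n => by
        rw [sub_nonneg]
        have hn : (0 : ℝ) ≤ n := n.cast_nonneg
        gcongr
        nlinarith) tendsto_centralRatio_sq.neg
  rw [centralRatio_zero] at h
  have h2 := hasSum_centralRatio_sq_div_succ.sub h
  norm_num at h2
  refine h2.congr_fun fun n => ?_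
  rfl

theorem hasSum_centralRatio_sq_div_pow_four :
    HasSum (fun n : ℕ => 1 / (2 * (n : ℝ) - 1) ^ 4 * centralRatio n ^ 2)
      (3 * π ^ 2 / 8 + log 2 ^ 2 / 2 - 16 / π * (polyLog 3 ((1 + Complex.I) / 2)).im
        - 8 / π * (catalanConstant - 1)) := by
  -- The term n = 0 equals 1. The term n + 1 is c_n²/((2n+1)²(2n+2)²), and squaring 1/(2n+1) -
  -- 1/(2n+2) gives 1/(2n+1)² + 1/(4(n+1)²) + 1/(n+1) - 2/(2n+1).
  rw [← hasSum_nat_add_iff' 1]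
  have h := ((hasSum_centralRatio_sq_div_sq.add hasSum_centralRatio_sq_div_succ_sq).add
    hasSum_centralRatio_sq_div_succ).sub (hasSum_centralRatio_sq_div.mul_left 2)
  convert h using 1
  · funext n
    rw [centralRatio_succ]
    have e : 2 * ((n + 1 : ℕ) : ℝ) - 1 = 2 * n + 1 := by push_cast; ring
    rw [e]
    field_simp
    ring
  · simp only [Finset.range_one, Finset.sum_singleton, centralRatio_zero]
    norm_num
    ring

theorem mainTheorem5 :
    (Summable (hypergeometricTerm ![1/2, 1/2, 1/2, 1/2] ![1, 3/2, 3/2] 1) ∧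
      HasSum (fun n : ℕ => 1 / (2 * (n : ℝ) + 1) ^ 2 * (1 / 4 ^ n * ((2 * n).choose n : ℝ)) ^ 2)
        (hypergeometricPFQ ![1/2, 1/2, 1/2, 1/2] ![1, 3/2, 3/2] 1) ∧
      hypergeometricPFQ ![1/2, 1/2, 1/2, 1/2] ![1, 3/2, 3/2] 1 =
        3 * Real.pi ^ 2 / 8 + Real.log 2 ^ 2 / 2
          - 16 / Real.pi * (polyLog 3 ((1 + Complex.I) / 2)).im) ∧
    (Summable (hypergeometricTerm ![-1/2, -1/2, -1/2, -1/2] ![1, 1/2, 1/2] 1) ∧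
      HasSum (fun n : ℕ => 1 / (2 * (n : ℝ) - 1) ^ 4 * (1 / 4 ^ n * ((2 * n).choose n : ℝ)) ^ 2)
        (hypergeometricPFQ ![-1/2, -1/2, -1/2, -1/2] ![1, 1/2, 1/2] 1) ∧
      hypergeometricPFQ ![-1/2, -1/2, -1/2, -1/2] ![1, 1/2, 1/2] 1 =
        3 * Real.pi ^ 2 / 8 + Real.log 2 ^ 2 / 2
          - 16 / Real.pi * (polyLog 3 ((1 + Complex.I) / 2)).im
          - 8 / Real.pi * (catalanConstant - 1)) := by
  have h1 := hasSum_centralRatio_sq_div_sq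
  have h2 := hasSum_centralRatio_sq_div_pow_four
  have t1 := h1.congr_fun hypergeometricTerm_one_half
  have t2 := h2.congr_fun hypergeometricTerm_neg_one_half
  have s1 := t1.tsum_eq
  have s2 := t2.tsum_eq
  refine ⟨⟨t1.summable, ?_, s1⟩, t2.summable, ?_, s2⟩
  · rw [hypergeometricPFQ, s1]
    exact h1
  · rw [hypergeometricPFQ, s2]
    exact h2
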